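/- All graphs are finite multigraphs (self-loops and parallel edges allowed); a self-loop is a cycle of length $1$, a pair of parallel edges is a cycle of length $2$, a self-loop contributes $2$ to the degree, and $\log=\log_2$. A feedback vertex set of $G$ is a set $F\subseteq V(G)$ such that $G-F$ contains no cycle. Let $\mathrm{reduce}(G)$ denote a graph obtained from $G$ by exhaustively applying, in any order, the following rules: (A1) delete a vertex of degree at most $1$; (A2) delete a vertex of degree exactly $2$ that has no self-loop and join its two (not necessarily distinct) neighbours by a new edge; (A3) if an edge (possibly a self-loop) has multiplicity larger than $2$, reduce its multiplicity to $2$. The girth is the least length of a cycle ($\infty$ if there is none). For a real constant $c$, a multigraph $G$ and integers $k>0$, $g>6$, consider the following procedure. First, obtain either $k$ vertex-disjoint cycles of $G$ (and return them) or a feedback vertex set $F$ of $G$ with $|F|\le ck\log k$. In the latter case, start with $S=\emptyset$ and repeat: if $\mathrm{reduce}(G-S)$ has girth larger than $g$, return $S$; otherwise take a shortest cycle $C$ of $\mathrm{reduce}(G-S)$ (which has length at most $g$) and replace $S$ by $S\cup V(C)$. If $k$ cycles $C$ have been taken, stop and return $k$ vertex-disjoint cycles of $G$ obtained from them. Then: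 (i) there is a constant $c>0$ such that every multigraph $G$ contains, for every integer $k\ge 0$, either $k$ vertex-disjoint cycles or a feedback vertex set of size at most $ck\log k$ (where $0\log 0=0$), so that the first step is always possible; and (ii) for every real $c$, every multigraph $G$ and all integers $k>0$ and $g>6$, if the procedure returns a set $S$, and $\mathrm{reduce}(G-S)$ is the reduced graph in its final iteration, then $$|V(\mathrm{reduce}(G-S))|\le (2ck\log k)^{1+\frac{6}{g-6}}+3ck\log k .$$ -/

import Mathlib

universe u v

open scoped Graph

namespace Graph

variable {α : Type u} {β : Type v}

/-- The multigraph `G + e`, where the edge `e` joins `x` and `y`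
(a self-loop if `x = y`). If `e` was already an edge, it is replaced. -/
def addEdge (G : Graph α β) (e : β) (x y : α) : Graph α β where
  vertexSet := V(G) ∪ {x, y}
  IsLink d a b := (d ≠ e ∧ G.IsLink d a b) ∨ (d = e ∧ ((a = x ∧ b = y) ∨ (a = y ∧ b = x)))
  isLink_symm d _ := ⟨by
    rintro a b (⟨h, h'⟩ | ⟨h, h' | h'⟩)
    · exact Or.inl ⟨h, h'.symm⟩
    · exact Or.inr ⟨h, Or.inr ⟨h'.2, h'.1⟩⟩
    · exact Or.inr ⟨h, Or.inl ⟨h'.2, h'.1⟩⟩⟩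
  eq_or_eq_of_isLink_of_isLink := by
    rintro d a b c w (⟨h, h'⟩ | ⟨h, h'⟩) (⟨k, k'⟩ | ⟨k, k'⟩)
    · exact h'.left_eq_or_eq k'
    · exact absurd k h
    · exact absurd h k
    · grind
  left_mem_of_isLink := by
    rintro d a b (⟨_, h⟩ | ⟨_, h | h⟩)
    · exact Or.inl h.left_mem
    · exact Or.inr (Or.inl h.1)
    · exact Or.inr (Or.inr h.1)

/-- The degree of `x`: the number of incident edges, a self-loop counting twice. -/
noncomputable def deg (G : Graph α β) (x : α) : ℕ :=
  {e | G.IsNonloopAt e x}.ncard + 2 * {e | G.IsLoopAt e x}.ncard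

/-- The set of edges joining `x` and `y` (the self-loops at `x` if `x = y`);
its size is the multiplicity of the edge `{x, y}`. -/
def edgesBetween (G : Graph α β) (x y : α) : Set β := {e | G.IsLink e x y}

/-- A cycle of a multigraph, with `len = n + 1` vertices: distinct vertices
`vert 0, …, vert n` and distinct edges `edge i` joining `vert i` to `vert (i + 1)`, the
addition being modulo `n + 1`. A self-loop is a cycle of length `1`, and two parallel edges
form a cycle of length `2`. -/
structure Cycle (G : Graph α β) where
  n : ℕ
  vert : Fin (n + 1) → α
  edge : Fin (n + 1) → β
  vert_injective : Function.Injective vert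
  edge_injective : Function.Injective edge
  isLink : ∀ i, G.IsLink (edge i) (vert i) (vert (i + 1))

/-- The length of a cycle is its number of vertices. -/
def Cycle.len {G : Graph α β} (C : G.Cycle) : ℕ := C.n + 1

/-- The vertex set of a cycle. -/
def Cycle.verts {G : Graph α β} (C : G.Cycle) : Set α := Set.range C.vert

/-- `C` is a shortest cycle of `G`. -/
def Cycle.IsShortest {G : Graph α β} (C : G.Cycle) : Prop := ∀ C' : G.Cycle, C.len ≤ C'.len

/-- `G` contains `k` pairwise vertex-disjoint cycles. -/
def HasDisjointCycles (G : Graph α β) (k : ℕ) : Prop :=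
  ∃ C : Fin k → G.Cycle, Pairwise fun i j => Disjoint (C i).verts (C j).verts

/-- `F` is a feedback vertex set of `G`: a set of vertices such that `G - F` is a forest. -/
def IsFeedbackVertexSet (G : Graph α β) (F : Set α) : Prop :=
  F ⊆ V(G) ∧ IsEmpty (G.deleteVerts F).Cycle

/-- The girth of `G`: the least length of a cycle, infinite if there is no cycle. -/
noncomputable def girth (G : Graph α β) : ℕ∞ := ⨅ C : G.Cycle, (C.len : ℕ∞)

/-- A single application of one of the three reduction rules. -/
inductive ReductionStep : Graph α β → Graph α β → Prop
  /-- Delete a vertex of degree at most one. -/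
  | delete {G : Graph α β} {x : α} (hx : x ∈ V(G)) (hdeg : G.deg x ≤ 1) :
      ReductionStep G (G.deleteVerts {x})
  /-- Delete a vertex `x` of degree exactly two that has no self-loop, and join its two
  (not necessarily distinct) neighbours `y` and `z` by a new edge `d`. -/
  | bypass {G : Graph α β} {x y z : α} {e f d : β}
      (hdeg : G.deg x = 2) (hloop : ∀ l, ¬ G.IsLoopAt l x)
      (hef : e ≠ f) (he : G.IsLink e x y) (hf : G.IsLink f x z)
      (hd : d ∉ E(G.deleteVerts {x})) :
      ReductionStep G ((G.deleteVerts {x}).addEdge d y z)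
  /-- Reduce the multiplicity of an edge from more than two to two. -/
  | truncate {G : Graph α β} {x y : α} {D : Set β}
      (hmul : 2 < (G.edgesBetween x y).ncard) (hD : D ⊆ G.edgesBetween x y)
      (hleft : (G.edgesBetween x y \ D).ncard = 2) :
      ReductionStep G (G.deleteEdges D)

/-- `R` is obtained from `G` by an exhaustive application of the reduction rules, in any
order: `R = reduce(G)`. -/
def IsReduced (G R : Graph α β) : Prop :=
  Relation.ReflTransGen ReductionStep G R ∧ ∀ H, ¬ ReductionStep R H

/-- The states of the loop that removes short cycles from `G`: `ShortCycleLoop G g n S` says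
that `S` is a possible value of the set of removed vertices after `n` iterations. An iteration
takes a shortest cycle `C` of `reduce(G - S)` and, if its length is at most `g`, adds its
vertices to `S`. -/
inductive ShortCycleLoop (G : Graph α β) (g : ℕ) : ℕ → Set α → Prop
  | init : ShortCycleLoop G g 0 ∅
  | step {n : ℕ} {S : Set α} {R : Graph α β} (C : R.Cycle)
      (hS : ShortCycleLoop G g n S) (hR : IsReduced (G.deleteVerts S) R)
      (hC : C.IsShortest) (hlen : C.len ≤ g) :
      ShortCycleLoop G g (n + 1) (S ∪ C.verts)

/-- `S` is a possible output of the following procedure on the input `(G, k, g)`, and `R` is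
the reduced graph `reduce(G - S)`. First either `k` vertex-disjoint cycles of `G` are returned
or a feedback vertex set `F` of `G` with `|F| ≤ c k log k` is obtained. In the latter case the
loop above is run. If it makes `k` iterations, the `k` cycles that it met yield `k`
vertex-disjoint cycles of `G`, which are returned. Otherwise it ends after `n < k` iterations,
since `reduce(G - S)` has no cycle of length at most `g`, and `S` is returned. -/
def IsPackingOutput (c : ℝ) (G : Graph α β) (k g : ℕ) (S : Set α) (R : Graph α β) : Prop :=
  (∃ F, G.IsFeedbackVertexSet F ∧ (F.ncard : ℝ) ≤ c * k * Real.logb 2 k) ∧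
  (∃ n < k, ShortCycleLoop G g n S) ∧
  IsReduced (G.deleteVerts S) R ∧ (g : ℕ∞) < R.girth

/-- `c` is an Erdős–Pósa constant: for every `k`, every finite multigraph contains `k`
vertex-disjoint cycles or has a feedback vertex set of size at most `c k log k`. -/
def IsErdosPosaConstant (c : ℝ) : Prop :=
  ∀ (α : Type u) (β : Type v) (G : Graph α β) (k : ℕ), V(G).Finite → E(G).Finite →
    G.HasDisjointCycles k ∨
      ∃ F, G.IsFeedbackVertexSet F ∧ (F.ncard : ℝ) ≤ c * k * Real.logb 2 k

end Graph

/-! For (ii), let `R` be the final reduced graph. A set that meets all cycles of `G` meets those of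
`G - S`, and each reduction step allows it to be replaced by a set that is no larger and meets all
cycles of the new graph (`exists_not_hasCycleIn_of_reduction`). No rule applies to `R` and its girth
exceeds `g > 6`, so `R` is simple of minimum degree at least three. Let `A` be the part of the
transported set in `R`; the other vertices induce a forest. Attach every vertex with a neighbour in
`A` to one such neighbour and contract the resulting stars, which gives a graph on `A`. Counting
degrees shows that at most three times as many vertices lie outside `A` as this graph has edges
(`two_mul_card_compl_le`). Contracting stars divides the girth by at most three, so the Moore bound
for irregular graphs (`sum_degree_le`) applies with `t = ⌊g/6⌋` and bounds the number of darts by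
`|A|^(1+1/t) + |A|`; finally `1/t ≤ 6/(g-6)`.

For (i), alternately reduce and remove a cycle of length at most `8r + 2`, where `2^r ≥ 5k` and `r =
O(log k)`. Removing `k` cycles yields `k` disjoint cycles of `G`. If the graph becomes empty
earlier, the vertices of the removed cycles form a feedback vertex set. Otherwise a nonempty reduced
graph of larger girth is left. Breadth-first trees around a maximal set of pairwise distant vertices
contract to a graph of minimum degree at least `5k` (`exists_disjoint_walks`); this graph contains
`k` disjoint cycles (`exists_disjoint_of_le_degree`), and they lift. -/

namespace Graph

variable {α : Type u} {β : Type v}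

/-! ### Cycles from walks and from edge counts -/

/-- An edge of a simple graph together with a walk that avoids it yields a short cycle in every
multigraph in which the simple graph embeds. -/
lemma exists_cycle_of_walk {V : Type*} {Γ : SimpleGraph V} {G : Graph α β} {ι : V → α}
    (hι : Function.Injective ι) (hadj : ∀ a b, Γ.Adj a b → G.Adj (ι a) (ι b)) {a b : V}
    (hab : Γ.Adj a b) (p : Γ.Walk b a) (hp : s(a, b) ∉ p.edges) :
    ∃ C : G.Cycle, C.len ≤ p.length + 1 ∧ ∀ x ∈ C.verts, ∃ v ∈ p.support, ι v = x := by
  classical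
  set q := p.bypass with hq
  have hqp : q.IsPath := p.bypass_isPath
  have hql : q.length ≤ p.length := p.length_bypass_le_length
  have hqe : s(a, b) ∉ q.edges := fun h => hp (p.edges_bypass_subset_edges h)
  -- A path of length 0 would identify the ends of an edge, and one of length 1 would be the avoided
  -- edge itself.
  have hn : 2 ≤ q.length := by
    by_contra! hlt
    rcases Nat.lt_succ_iff_lt_or_eq.1 hlt with h0 | h1
    · exact hab.ne (SimpleGraph.Walk.eq_of_length_eq_zero (p := q) (by omega)).symm
    · have aux : ∀ {x y : V} (r : Γ.Walk x y), r.length = 1 → s(y, x) ∈ r.edges := by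
        intro x y r hr
        cases r with
        | nil => simp at hr
        | cons h t =>
          cases t with
          | nil => simp
          | cons => simp at hr
      exact hqe (aux q h1)
  have hinj : ∀ i j : Fin (q.length + 1), q.getVert i = q.getVert j → i = j := fun i j h =>
    Fin.ext (hqp.getVert_injOn (by simp; omega) (by simp; omega) h)
  have hlink : ∀ i : Fin (q.length + 1), ∃ e,
      G.IsLink e (ι (q.getVert i)) (ι (q.getVert (i + 1 : Fin (q.length + 1)))) := by
    intro i
    rcases Nat.lt_succ_iff_lt_or_eq.1 i.2 with h | h
    · rw [Fin.val_add_one_of_lt' (by omega)]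
      exact hadj _ _ (q.adj_getVert_succ h)
    · have h' : i = Fin.last _ := Fin.ext h
      rw [h', Fin.last_add_one]
      simpa [Graph.Adj] using! hadj _ _ hab
  choose e he using hlink
  refine ⟨⟨q.length, fun i => ι (q.getVert i), e, fun i j h => hinj i j (hι h), ?_, he⟩,
    by simpa [Cycle.len] using hql, ?_⟩
  · intro i j hij
    have h1 := he i
    rw [hij] at h1
    rcases h1.eq_and_eq_or_eq_and_eq (he j) with ⟨h, -⟩ | ⟨h, h'⟩
    · exact hinj _ _ (hι h)
    · have e1 := hinj _ _ (hι h)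
      have e2 := hinj _ _ (hι h')
      exfalso
      -- An edge used twice with its ends swapped would give `i = j + 1` and `j = i + 1`, impossible
      -- modulo a number that is at least 3.
      have e3 : (1 : Fin (q.length + 1)) + 1 = 0 := by
        have : j + 1 + 1 = j := by rw [← e1]; exact e2
        rw [add_assoc] at this
        simpa using this
      have := congrArg Fin.val e3
      simp only [Fin.val_add, Fin.val_one', Nat.mod_add_mod, Nat.add_mod_mod, Fin.val_zero] at this
      rw [Nat.mod_eq_of_lt (by omega)] at this
      omega
  · rintro x ⟨i, rfl⟩
    exact ⟨_, p.support_bypass_subset_support (q.getVert_mem_support i), rfl⟩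

/-- `G` has a cycle all of whose vertices lie in `W`. -/
def HasCycleIn (G : Graph α β) (W : Set α) : Prop := ∃ C : G.Cycle, C.verts ⊆ W

/-- `W` induces a subgraph of minimum degree at least two. -/
def IsCore (G : Graph α β) (W : Set α) : Prop :=
  W.Nonempty ∧ ∀ v ∈ W, (∃ e, G.IsLoopAt e v) ∨
    ∃ e f y z, e ≠ f ∧ G.IsLink e v y ∧ G.IsLink f v z ∧ y ∈ W ∧ z ∈ W

/-- The subgraph induced by a set of vertices with enough darts contains a cycle. -/
lemma _root_.SimpleGraph.exists_walk_of_card_le {V : Type*} [Fintype V] [DecidableEq V]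
    (Γ : SimpleGraph V) [DecidableRel Γ.Adj] {W : Finset V} (hW : W.Nonempty)
    (h : 2 * W.card ≤ ∑ v ∈ W, (W.filter (Γ.Adj v)).card) :
    ∃ a b, Γ.Adj a b ∧ ∃ p : Γ.Walk b a, s(a, b) ∉ p.edges ∧ ∀ x ∈ p.support, x ∈ W := by
  classical
  set I := Γ.induce (W : Set V) with hI
  have : Nonempty (W : Set V) := hW.to_subtype
  have hnot : ¬ I.IsAcyclic := by
    intro hac
    -- If `I` were acyclic it would extend to a spanning tree of the complete graph on `W`, which
    -- has only `|W| - 1` edges.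
    obtain ⟨T, hT, hmax⟩ := SimpleGraph.exists_maximal_isAcyclic_of_le_isAcyclic
      (G := (⊤ : SimpleGraph (W : Set V))) le_top hac
    have htree : T.IsTree := by
      have := (SimpleGraph.maximal_isAcyclic_iff_isTree (T := T)).1
      exact this (by simpa using hmax)
    have h1 := htree.card_edgeFinset
    have h2 := I.sum_degrees_eq_twice_card_edges
    have h3 : I.edgeFinset.card ≤ T.edgeFinset.card :=
      Finset.card_le_card (SimpleGraph.edgeFinset_mono hT)
    have h4 : ∑ v, I.degree v = ∑ v ∈ W, (W.filter (Γ.Adj v)).card := by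
      rw [← Finset.sum_coe_sort W]
      refine Finset.sum_congr rfl fun v _ => ?_
      rw [← SimpleGraph.card_neighborFinset_eq_degree]
      refine Finset.card_bij (fun x _ => x.1) ?_ ?_ ?_
      · intro a ha
        simpa [hI] using ha
      · intro a _ b _ hab
        exact Subtype.ext hab
      · intro b hb
        have hb' := Finset.mem_filter.1 hb
        exact ⟨⟨b, hb'.1⟩, by simpa [hI] using hb'.2, rfl⟩
    simp at h1
    omega
  rw [SimpleGraph.isAcyclic_iff_forall_adj_isBridge] at hnot
  push Not at hnot
  obtain ⟨a, b, hab, hbr⟩ := hnot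
  rw [SimpleGraph.isBridge_iff_forall_walk_mem_edges] at hbr
  push Not at hbr
  obtain ⟨p, hp⟩ := hbr
  let f : I →g Γ := ⟨Subtype.val, fun {x y} h => by simpa [hI] using h⟩
  refine ⟨f a, f b, f.map_adj hab, p.reverse.map f, ?_, ?_⟩
  · intro h
    rw [SimpleGraph.Walk.edges_map, List.mem_map] at h
    obtain ⟨e, he, hee⟩ := h
    have : e = s(a, b) := Sym2.map.injective (f := ⇑f) (fun _ _ h => Subtype.ext h) hee
    rw [this] at he
    exact hp (by simpa using he)
  · intro x hx
    rw [SimpleGraph.Walk.support_map, List.mem_map] at hx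
    obtain ⟨y, -, rfl⟩ := hx
    exact y.2

end Graph

/-! ### Cores as a local substitute for cycles -/

namespace Graph

variable {α : Type u} {β : Type v} {G H : Graph α β} {U W : Set α}

lemma IsCore.subset_vertexSet (h : G.IsCore U) : U ⊆ V(G) := fun v hv => by
  rcases h.2 v hv with ⟨e, he⟩ | ⟨e, f, y, z, -, he, -⟩
  exacts [he.vertex_mem, he.left_mem]

lemma HasCycleIn.mono (h : G.HasCycleIn U) (hUW : U ⊆ W) : G.HasCycleIn W :=
  h.imp fun _ hC => hC.trans hUW

lemma Cycle.isCore (C : G.Cycle) : G.IsCore C.verts := by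
  obtain ⟨n, vert, edge, hv, he, hl⟩ := C
  refine ⟨⟨_, 0, rfl⟩, ?_⟩
  rintro _ ⟨i, rfl⟩
  dsimp only
  rcases Nat.eq_zero_or_pos n with rfl | hn
  · left
    refine ⟨edge i, ?_⟩
    have := hl i
    have h1 : ∀ j : Fin (0 + 1), j + 1 = j := by decide
    rwa [h1 i] at this
  · right
    refine ⟨edge i, edge (i - 1), vert (i + 1), vert (i - 1), ?_, hl i, ?_, ⟨_, rfl⟩, ⟨_, rfl⟩⟩
    · intro h
      have h1 := he h
      have : (1 : Fin (n + 1)) = 0 := by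
        have := sub_eq_self.1 h1.symm
        exact this
      have := congrArg Fin.val this
      rw [Fin.val_one', Nat.mod_eq_of_lt (by omega)] at this
      simp at this
    · have := (hl (i - 1)).symm
      rwa [sub_add_cancel] at this

lemma exists_cycle_of_isLoopAt {e : β} {x : α} (h : G.IsLoopAt e x) :
    ∃ C : G.Cycle, C.len = 1 ∧ C.verts ⊆ {x} :=
  ⟨⟨0, fun _ => x, fun _ => e, fun _ _ _ => Fin.ext (by omega),
    fun _ _ _ => Fin.ext (by omega), fun _ => h⟩, rfl, by rintro _ ⟨_, rfl⟩; rfl⟩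

lemma exists_cycle_of_parallel {e f : β} {x y : α} (hxy : x ≠ y) (hef : e ≠ f)
    (he : G.IsLink e x y) (hf : G.IsLink f x y) :
    ∃ C : G.Cycle, C.len = 2 ∧ C.verts ⊆ {x, y} := by
  refine ⟨⟨1, ![x, y], ![e, f], ?_, ?_, ?_⟩, rfl, ?_⟩
  · intro i j; fin_cases i <;> fin_cases j <;> simp [hxy, hxy.symm]
  · intro i j; fin_cases i <;> fin_cases j <;> simp [hef, hef.symm]
  · intro i; fin_cases i
    · simpa using he
    · simpa using hf.symm
  · rintro _ ⟨i, rfl⟩; fin_cases i <;> simp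

/-- A loop or a parallel pair inside `U` is already a cycle. Without them, the two edges at each
vertex lead to distinct neighbours in `U`, so `U` induces a simple graph with at least as many edges
as vertices. -/
lemma IsCore.hasCycleIn (h : G.IsCore U) (hV : V(G).Finite) : G.HasCycleIn U := by
  classical
  by_contra hno
  have hloop : ∀ v ∈ U, ∀ e, ¬ G.IsLoopAt e v := fun v hv e he => by
    obtain ⟨C, -, hC⟩ := exists_cycle_of_isLoopAt he
    exact hno ⟨C, hC.trans (by simpa using hv)⟩
  have hpar : ∀ x ∈ U, ∀ y ∈ U, ∀ e f, G.IsLink e x y → G.IsLink f x y → e = f := by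
    intro x hx y hy e f he hf
    by_contra hef
    have hxy : x ≠ y := by rintro rfl; exact hloop x hx e he
    obtain ⟨C, -, hC⟩ := exists_cycle_of_parallel hxy hef he hf
    exact hno ⟨C, hC.trans (by rintro _ (rfl | rfl) <;> assumption)⟩
  have : Finite U := hV.subset h.subset_vertexSet
  have := Fintype.ofFinite U
  let Γ : SimpleGraph U :=
    { Adj := fun a b => a ≠ b ∧ G.Adj a b
      symm := ⟨fun a b h => ⟨h.1.symm, h.2.symm⟩⟩
      loopless := ⟨fun a h => h.1 rfl⟩ }
  have hne : (Finset.univ : Finset U).Nonempty := by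
    obtain ⟨x, hx⟩ := h.1
    exact ⟨⟨x, hx⟩, Finset.mem_univ _⟩
  obtain ⟨a, b, hab, p, hp, -⟩ := Γ.exists_walk_of_card_le hne (by
    rw [mul_comm, ← smul_eq_mul]
    refine Finset.card_nsmul_le_sum _ _ _ fun v _ => ?_
    rcases h.2 v v.2 with ⟨e, he⟩ | ⟨e, f, y, z, hef, he, hf, hy, hz⟩
    · exact absurd he (hloop v v.2 e)
    · have hyz : y ≠ z := by rintro rfl; exact hef (hpar v v.2 y hy e f he hf)
      have hsub : ({⟨y, hy⟩, ⟨z, hz⟩} : Finset U) ⊆ Finset.univ.filter (Γ.Adj v) := by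
        intro w hw
        simp only [Finset.mem_insert, Finset.mem_singleton] at hw
        rw [Finset.mem_filter]
        refine ⟨Finset.mem_univ _, ?_⟩
        rcases hw with rfl | rfl
        · refine ⟨fun hv => ?_, e, he⟩
          have hv' : (v : α) = y := congrArg Subtype.val hv
          rw [← hv'] at he
          exact hloop v v.2 e he
        · refine ⟨fun hv => ?_, f, hf⟩
          have hv' : (v : α) = z := congrArg Subtype.val hv
          rw [← hv'] at hf
          exact hloop v v.2 f hf
      refine le_trans (Finset.card_pair ?_).ge (Finset.card_le_card hsub)
      intro h; exact hyz (congrArg Subtype.val h))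
  obtain ⟨C, -, hC⟩ := exists_cycle_of_walk (Γ := Γ) (G := G) Subtype.val_injective
    (fun _ _ h => h.2) hab p hp
  refine hno ⟨C, fun x hx => ?_⟩
  obtain ⟨v, -, rfl⟩ := hC x hx
  exact v.2

lemma HasCycleIn.exists_isCore (h : G.HasCycleIn W) : ∃ U ⊆ W, G.IsCore U := by
  obtain ⟨C, hC⟩ := h
  exact ⟨_, hC, C.isCore⟩

/-- The core condition is checked vertex by vertex, so it can be followed through a reduction step
without re-indexing a cycle. -/
lemma hasCycleIn_iff (hV : V(G).Finite) : G.HasCycleIn W ↔ ∃ U ⊆ W, G.IsCore U :=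
  ⟨HasCycleIn.exists_isCore, fun ⟨_, hU, h⟩ => (h.hasCycleIn hV).mono hU⟩

lemma IsCore.of_le (h : H.IsCore U) (hle : H ≤ G) : G.IsCore U := by
  refine ⟨h.1, fun v hv => (h.2 v hv).imp ?_ ?_⟩
  · rintro ⟨e, he⟩; exact ⟨e, he.mono hle⟩
  · rintro ⟨e, f, y, z, hef, he, hf, hy⟩; exact ⟨e, f, y, z, hef, he.mono hle, hf.mono hle, hy⟩

lemma HasCycleIn.of_le (h : H.HasCycleIn U) (hle : H ≤ G) : G.HasCycleIn U := by
  obtain ⟨C, hC⟩ := h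
  exact ⟨⟨C.n, C.vert, C.edge, C.vert_injective, C.edge_injective, fun i => (C.isLink i).mono hle⟩,
    hC⟩

lemma IsCore.deleteVerts {X : Set α} (h : G.IsCore U) (hX : Disjoint U X) :
    (G.deleteVerts X).IsCore U := by
  have hn : ∀ v ∈ U, v ∉ X := fun v hv hv' => Set.disjoint_left.1 hX hv hv'
  refine ⟨h.1, fun v hv => (h.2 v hv).imp ?_ ?_⟩
  · rintro ⟨e, he⟩
    exact ⟨e, (deleteVerts_isLink _ _).2 ⟨he, hn v hv, hn v hv⟩⟩
  · rintro ⟨e, f, y, z, hef, he, hf, hy, hz⟩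
    exact ⟨e, f, y, z, hef, (deleteVerts_isLink _ _).2 ⟨he, hn _ hv, hn _ hy⟩,
      (deleteVerts_isLink _ _).2 ⟨hf, hn _ hv, hn _ hz⟩, hy, hz⟩

lemma IsCore.disjoint_of_deleteVerts {X : Set α} (h : (G.deleteVerts X).IsCore U) :
    Disjoint U X := by
  rw [Set.disjoint_left]
  intro v hv
  exact (h.subset_vertexSet hv).2

/-- A set of vertices meets every cycle if and only if its deletion leaves no cycle. -/
lemma not_hasCycleIn_compl_iff {F : Set α} (hV : V(G).Finite) :
    ¬ G.HasCycleIn Fᶜ ↔ IsEmpty (G.deleteVerts F).Cycle := by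
  rw [not_iff_comm, not_isEmpty_iff]
  constructor
  · rintro ⟨C⟩
    rw [hasCycleIn_iff hV]
    exact ⟨_, Set.subset_compl_iff_disjoint_right.2 C.isCore.disjoint_of_deleteVerts,
      C.isCore.of_le deleteVerts_le⟩
  · intro h
    obtain ⟨U, hU, hc⟩ := h.exists_isCore
    obtain ⟨C, -⟩ := (hc.deleteVerts (Set.subset_compl_iff_disjoint_right.1 hU)).hasCycleIn
      (hV.subset (by simp))
    exact ⟨C⟩

/-- Allowing sets larger than the cycles inside them lets a deleted vertex be added back before the
cycle is chosen. -/
lemma hasDisjointCycles_iff {k : ℕ} : G.HasDisjointCycles k ↔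
    ∃ W : Fin k → Set α, (Pairwise fun i j => Disjoint (W i) (W j)) ∧ ∀ i, G.HasCycleIn (W i) := by
  constructor
  · rintro ⟨C, hC⟩
    exact ⟨fun i => (C i).verts, hC, fun i => ⟨C i, le_rfl⟩⟩
  · rintro ⟨W, hW, h⟩
    choose C hC using h
    exact ⟨C, fun i j hij => (hW hij).mono (hC i) (hC j)⟩

lemma HasDisjointCycles.of_le {k : ℕ} (h : H.HasDisjointCycles k) (hle : H ≤ G) :
    G.HasDisjointCycles k := by
  rw [hasDisjointCycles_iff] at h ⊢
  obtain ⟨W, hW, h⟩ := h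
  exact ⟨W, hW, fun i => (h i).of_le hle⟩

end Graph

/-! ### Effect of the reduction rules on cores -/

namespace Graph

variable {α : Type u} {β : Type v} {G H : Graph α β} {U W : Set α}

lemma addEdge_isLink {e d : β} {x y a b : α} : (G.addEdge e x y).IsLink d a b ↔
    (d ≠ e ∧ G.IsLink d a b) ∨ (d = e ∧ ((a = x ∧ b = y) ∨ (a = y ∧ b = x))) := Iff.rfl

lemma le_addEdge {e : β} {x y : α} (he : e ∉ E(G)) : G ≤ G.addEdge e x y where
  vertexSet_mono := Set.subset_union_left
  isLink_mono _ _ _ h := Or.inl ⟨fun h' => he (h' ▸ h.edge_mem), h⟩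

lemma edgeSet_addEdge_subset {e : β} {x y : α} : E(G.addEdge e x y) ⊆ insert e E(G) := by
  intro d hd
  obtain ⟨a, b, h⟩ := exists_isLink_of_mem_edgeSet hd
  rcases addEdge_isLink.1 h with ⟨-, h⟩ | ⟨rfl, -⟩
  exacts [Or.inr h.edge_mem, Or.inl rfl]

/-- A vertex of a core is incident with a loop or with two further edges. -/
lemma IsCore.two_le_deg (h : G.IsCore U) (hE : E(G).Finite) {x : α} (hx : x ∈ U) :
    2 ≤ G.deg x := by
  unfold deg
  rcases h.2 x hx with ⟨e, he⟩ | ⟨e, f, y, z, hef, he, hf, hy, hz⟩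
  · have : 0 < {e | G.IsLoopAt e x}.ncard :=
      (Set.ncard_pos (hE.subset fun _ h => h.edge_mem)).2 ⟨e, he⟩
    omega
  · by_cases hl : ∃ l, G.IsLoopAt l x
    · have : 0 < {e | G.IsLoopAt e x}.ncard :=
        (Set.ncard_pos (hE.subset fun _ h => h.edge_mem)).2 hl
      omega
    · push Not at hl
      have hne : ∀ {g w}, G.IsLink g x w → G.IsNonloopAt g x := fun {g w} hg =>
        ⟨w, by rintro rfl; exact hl g hg, hg⟩
      have : ({e, f} : Set β).ncard ≤ {e | G.IsNonloopAt e x}.ncard :=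
        Set.ncard_le_ncard (by rintro _ (rfl | rfl); exacts [hne he, hne hf])
          (hE.subset fun _ h => h.edge_mem)
      rw [Set.ncard_pair hef] at this
      omega

/-- At a vertex of degree two without loops there are just two edges. -/
lemma eq_or_eq_of_deg_eq_two (hE : E(G).Finite) {x y z : α} {e f : β} (hdeg : G.deg x = 2)
    (hloop : ∀ l, ¬ G.IsLoopAt l x) (hef : e ≠ f) (he : G.IsLink e x y) (hf : G.IsLink f x z)
    {g : β} (hg : G.Inc g x) : g = e ∨ g = f := by
  have hne : ∀ {g}, G.Inc g x → G.IsNonloopAt g x := fun {g} ⟨w, hw⟩ =>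
    ⟨w, by rintro rfl; exact hloop g hw, hw⟩
  by_contra! hcon
  have hsub : ({g, e, f} : Set β) ⊆ {e | G.IsNonloopAt e x} := by
    rintro _ (rfl | rfl | rfl)
    exacts [hne hg, hne he.inc_left, hne hf.inc_left]
  have := Set.ncard_le_ncard hsub (hE.subset fun _ h => h.edge_mem)
  rw [Set.ncard_insert_of_notMem (by simp [hcon]) (by simp), Set.ncard_pair hef] at this
  unfold deg at hdeg
  omega

section bypass

variable {x y z : α} {e f d : β}

/-- Deleting `x` and joining its neighbours `y` and `z` by the edge `d`. -/
lemma isCore_bypass (hE : E(G).Finite) (hdeg : G.deg x = 2) (hloop : ∀ l, ¬ G.IsLoopAt l x)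
    (hef : e ≠ f) (he : G.IsLink e x y) (hf : G.IsLink f x z)
    (hd : d ∉ E(G.deleteVerts {x})) (h : G.IsCore U) :
    ((G.deleteVerts {x}).addEdge d y z).IsCore (U \ {x}) := by
  have hyx : y ≠ x := by rintro rfl; exact hloop e he
  have hzx : z ≠ x := by rintro rfl; exact hloop f hf
  have hall : ∀ {g w}, G.IsLink g x w → (g = e ∧ w = y) ∨ (g = f ∧ w = z) := by
    intro g w hg
    rcases eq_or_eq_of_deg_eq_two hE hdeg hloop hef he hf hg.inc_left with rfl | rfl
    · exact Or.inl ⟨rfl, hg.right_unique he⟩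
    · exact Or.inr ⟨rfl, hg.right_unique hf⟩
  by_cases hxU : x ∈ U
  · have hU : y ∈ U ∧ z ∈ U := by
      rcases h.2 x hxU with ⟨l, hl⟩ | ⟨e', f', y', z', hef', he', hf', hy', hz'⟩
      · exact absurd hl (hloop l)
      · rcases hall he' with ⟨h1, h2⟩ | ⟨h1, h2⟩ <;> rcases hall hf' with ⟨h3, h4⟩ | ⟨h3, h4⟩ <;>
          subst h1 h2 h3 h4 <;> first | exact absurd rfl hef' | exact ⟨‹_›, ‹_›⟩
    have hdl : ((G.deleteVerts {x}).addEdge d y z).IsLink d y z := Or.inr ⟨rfl, Or.inl ⟨rfl, rfl⟩⟩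
    have hold : ∀ {g a b}, G.IsLink g a b → a ≠ x → b ≠ x →
        g ≠ d ∧ ((G.deleteVerts {x}).addEdge d y z).IsLink g a b := by
      intro g a b hg ha hb
      have h1 : (G.deleteVerts {x}).IsLink g a b := (deleteVerts_isLink _ _).2 ⟨hg, ha, hb⟩
      have h2 : g ≠ d := by rintro rfl; exact hd h1.edge_mem
      exact ⟨h2, Or.inl ⟨h2, h1⟩⟩
    refine ⟨⟨y, hU.1, hyx⟩, ?_⟩
    rintro v ⟨hv, hvx⟩
    have hvx : v ≠ x := hvx
    have hUx : ∀ {w}, w ∈ U → w ≠ x → w ∈ U \ {x} := fun hw hwx => ⟨hw, hwx⟩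
    rcases h.2 v hv with ⟨l, hl⟩ | ⟨e', f', y', z', hef', he', hf', hy', hz'⟩
    · exact Or.inl ⟨l, (hold hl hvx hvx).2⟩
    · by_cases h1 : y' = x <;> by_cases h2 : z' = x
      -- Both edges at `v` lead to `x`, so `v = y = z` and the new edge is a loop at `v`.
      · subst h1 h2
        left
        refine ⟨d, ?_⟩
        rcases hall he'.symm with ⟨a1, a2⟩ | ⟨a1, a2⟩ <;>
          rcases hall hf'.symm with ⟨a3, a4⟩ | ⟨a3, a4⟩
        · exact absurd (a1.trans a3.symm) hef'
        · rw [IsLoopAt]; convert hdl using 1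
        · rw [IsLoopAt]; convert hdl using 1
        · exact absurd (a1.trans a3.symm) hef'
      · subst h1
        right
        have h3 := hold hf' hvx h2
        rcases hall he'.symm with ⟨a1, a2⟩ | ⟨a1, a2⟩ <;> subst a2
        · exact ⟨d, f', z, z', h3.1.symm, hdl, h3.2, hUx hU.2 hzx, hUx hz' h2⟩
        · exact ⟨d, f', y, z', h3.1.symm, hdl.symm, h3.2, hUx hU.1 hyx, hUx hz' h2⟩
      · subst h2
        right
        have h3 := hold he' hvx h1
        rcases hall hf'.symm with ⟨a1, a2⟩ | ⟨a1, a2⟩ <;> subst a2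
        · exact ⟨d, e', z, y', h3.1.symm, hdl, h3.2, hUx hU.2 hzx, hUx hy' h1⟩
        · exact ⟨d, e', y, y', h3.1.symm, hdl.symm, h3.2, hUx hU.1 hyx, hUx hy' h1⟩
      · exact Or.inr ⟨e', f', y', z', hef', (hold he' hvx h1).2, (hold hf' hvx h2).2,
          hUx hy' h1, hUx hz' h2⟩
  · rw [Set.sdiff_singleton_eq_self hxU]
    exact (h.deleteVerts (by simpa using hxU)).of_le (le_addEdge hd)

/-- The new edge `d` matters inside `U` only if `U` contains both `y` and `z`; then `d` is replaced
by `e` or `f` through `x`, or by the parallel pair `e`, `f` if it is a loop. That `y ∈ U` in this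
case decides which of several disjoint cycles receives `x`, and lets `y` replace `x` in a feedback
vertex set. -/
lemma IsCore.of_bypass (hloop : ∀ l, ¬ G.IsLoopAt l x)
    (hef : e ≠ f) (he : G.IsLink e x y) (hf : G.IsLink f x z)
    (h : ((G.deleteVerts {x}).addEdge d y z).IsCore U) :
    x ∉ U ∧ (G.IsCore U ∨ (y ∈ U ∧ z ∈ U ∧ G.IsCore (insert x U))) := by
  have hyx : y ≠ x := by rintro rfl; exact hloop e he
  have hzx : z ≠ x := by rintro rfl; exact hloop f hf
  have hxU : x ∉ U := by
    intro hx
    rcases h.subset_vertexSet hx with h1 | h1 | h1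
    · exact h1.2 rfl
    · exact hyx h1.symm
    · exact hzx h1.symm
  have hold : ∀ {g a b}, ((G.deleteVerts {x}).addEdge d y z).IsLink g a b → g ≠ d →
      G.IsLink g a b ∧ g ≠ e ∧ g ≠ f := by
    intro g a b hg hgd
    rcases hg with ⟨-, hg⟩ | ⟨hg, -⟩
    · obtain ⟨h1, h2, h3⟩ := (deleteVerts_isLink _ _).1 hg
      refine ⟨h1, ?_, ?_⟩ <;> rintro rfl
      · rcases he.left_eq_or_eq h1 with h | h <;> subst h <;> simp_all
      · rcases hf.left_eq_or_eq h1 with h | h <;> subst h <;> simp_all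
    · exact absurd hg hgd
  have hnew : ∀ {a b}, ((G.deleteVerts {x}).addEdge d y z).IsLink d a b →
      (a = y ∧ b = z) ∨ (a = z ∧ b = y) := by
    intro a b hg
    rcases hg with ⟨h1, -⟩ | ⟨-, hg⟩
    exacts [absurd rfl h1, hg]
  refine ⟨hxU, ?_⟩
  by_cases hU : y ∈ U ∧ z ∈ U
  · right
    refine ⟨hU.1, hU.2, ⟨x, Or.inl rfl⟩, ?_⟩
    rintro v (rfl | hv)
    · exact Or.inr ⟨e, f, y, z, hef, he, hf, Or.inr hU.1, Or.inr hU.2⟩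
    · rcases h.2 v hv with ⟨l, hl⟩ | ⟨e', f', y', z', hef', he', hf', hy', hz'⟩
      · by_cases hld : l = d
        · subst hld
          right
          rcases hnew hl with ⟨h1, h2⟩ | ⟨h1, h2⟩
          · exact ⟨e, f, x, x, hef, h1 ▸ he.symm, h2 ▸ hf.symm, Or.inl rfl, Or.inl rfl⟩
          · exact ⟨e, f, x, x, hef, h2 ▸ he.symm, h1 ▸ hf.symm, Or.inl rfl, Or.inl rfl⟩
        · exact Or.inl ⟨l, (hold hl hld).1⟩
      · right
        by_cases h1 : e' = d <;> by_cases h2 : f' = d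
        · exact absurd (h1.trans h2.symm) hef'
        · subst h1
          obtain ⟨h3, h4, h5⟩ := hold hf' h2
          rcases hnew he' with ⟨h6, h7⟩ | ⟨h6, h7⟩
          · exact ⟨e, f', x, z', h4.symm, h6 ▸ he.symm, h3, Or.inl rfl, Or.inr hz'⟩
          · exact ⟨f, f', x, z', h5.symm, h6 ▸ hf.symm, h3, Or.inl rfl, Or.inr hz'⟩
        · subst h2
          obtain ⟨h3, h4, h5⟩ := hold he' h1
          rcases hnew hf' with ⟨h6, h7⟩ | ⟨h6, h7⟩
          · exact ⟨e, e', x, y', h4.symm, h6 ▸ he.symm, h3, Or.inl rfl, Or.inr hy'⟩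
          · exact ⟨f, e', x, y', h5.symm, h6 ▸ hf.symm, h3, Or.inl rfl, Or.inr hy'⟩
        · exact ⟨e', f', y', z', hef', (hold he' h1).1, (hold hf' h2).1, Or.inr hy', Or.inr hz'⟩
  · left
    have hne : ∀ {g a b}, ((G.deleteVerts {x}).addEdge d y z).IsLink g a b → a ∈ U → b ∈ U →
        G.IsLink g a b := by
      intro g a b hg ha hb
      refine (hold hg ?_).1
      rintro rfl
      rcases hnew hg with ⟨rfl, rfl⟩ | ⟨rfl, rfl⟩
      exacts [hU ⟨ha, hb⟩, hU ⟨hb, ha⟩]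
    refine ⟨h.1, fun v hv => (h.2 v hv).imp ?_ ?_⟩
    · rintro ⟨l, hl⟩; exact ⟨l, hne hl hv hv⟩
    · rintro ⟨e', f', y', z', hef', he', hf', hy', hz'⟩
      exact ⟨e', f', y', z', hef', hne he' hv hy', hne hf' hv hz', hy', hz'⟩

end bypass

/-- A vertex of `U` that loses an edge inside `U` keeps the two surviving copies, which suffice. -/
lemma isCore_truncate {x y : α} {D : Set β} (hD : D ⊆ G.edgesBetween x y)
    (hleft : (G.edgesBetween x y \ D).ncard = 2) (h : G.IsCore U) :
    (G.deleteEdges D).IsCore U := by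
  obtain ⟨e, f, hef, hset⟩ := Set.ncard_eq_two.1 hleft
  have hlink : ∀ {g}, g = e ∨ g = f → (G.deleteEdges D).IsLink g x y := by
    intro g hg
    have : g ∈ G.edgesBetween x y \ D := by rw [hset]; exact hg
    exact ⟨this.1, this.2⟩
  have key : ∀ {g v w}, g ∈ D → G.IsLink g v w → v ∈ U → w ∈ U →
      (∃ e, (G.deleteEdges D).IsLoopAt e v) ∨ ∃ e f y z, e ≠ f ∧ (G.deleteEdges D).IsLink e v y ∧
        (G.deleteEdges D).IsLink f v z ∧ y ∈ U ∧ z ∈ U := by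
    intro g v w hg hl hv hw
    right
    rcases hl.eq_and_eq_or_eq_and_eq (hD hg) with ⟨rfl, rfl⟩ | ⟨rfl, rfl⟩
    · exact ⟨e, f, w, w, hef, hlink (Or.inl rfl), hlink (Or.inr rfl), hw, hw⟩
    · exact ⟨e, f, w, w, hef, (hlink (Or.inl rfl)).symm, (hlink (Or.inr rfl)).symm, hw, hw⟩
  refine ⟨h.1, fun v hv => ?_⟩
  rcases h.2 v hv with ⟨l, hl⟩ | ⟨e', f', y', z', hef', he', hf', hy', hz'⟩
  · by_cases hlD : l ∈ D
    · exact key hlD hl hv hv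
    · exact Or.inl ⟨l, hl, hlD⟩
  · by_cases h1 : e' ∈ D
    · exact key h1 he' hv hy'
    by_cases h2 : f' ∈ D
    · exact key h2 hf' hv hz'
    exact Or.inr ⟨e', f', y', z', hef', ⟨he', h1⟩, ⟨hf', h2⟩, hy', hz'⟩

end Graph

/-! ### Invariants and termination of the reduction -/

namespace Graph

variable {α : Type u} {β : Type v} {G H R : Graph α β} {U W : Set α}

lemma ReductionStep.vertexSet_subset (h : ReductionStep G H) : V(H) ⊆ V(G) := by
  cases h with
  | delete hx hdeg => exact Set.sdiff_subset
  | @bypass x y z e f d hdeg hloop hef he hf hd =>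
    rintro w (hw | rfl | rfl)
    exacts [hw.1, he.right_mem, hf.right_mem]
  | truncate hmul hD hleft => exact le_rfl

lemma ReductionStep.edgeSet_finite (h : ReductionStep G H) (hE : E(G).Finite) : E(H).Finite := by
  cases h with
  | delete hx hdeg => exact hE.subset deleteVerts_le.edgeSet_mono
  | bypass => exact ((hE.subset deleteVerts_le.edgeSet_mono).insert _).subset edgeSet_addEdge_subset
  | truncate hmul hD hleft => exact hE.subset deleteEdges_le.edgeSet_mono

/-- This measure makes exhaustive reduction terminate. Bypassing loses a vertex and at least one
edge and adds at most one edge. -/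
lemma ReductionStep.ncard_lt (h : ReductionStep G H) (hV : V(G).Finite) (hE : E(G).Finite) :
    V(H).ncard + E(H).ncard < V(G).ncard + E(G).ncard := by
  cases h with
  | @delete x hx hdeg =>
    have h1 : V(G.deleteVerts {x}).ncard < V(G).ncard :=
      Set.ncard_lt_ncard (by simpa [Set.ssubset_iff_subset_ne] using hx) hV
    have h2 : E(G.deleteVerts {x}).ncard ≤ E(G).ncard :=
      Set.ncard_le_ncard deleteVerts_le.edgeSet_mono hE
    omega
  | @bypass x y z e f d hdeg hloop hef he hf hd =>
    have hyx : y ≠ x := by rintro rfl; exact hloop e he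
    have hzx : z ≠ x := by rintro rfl; exact hloop f hf
    have h1 : V((G.deleteVerts {x}).addEdge d y z) = V(G.deleteVerts {x}) := by
      refine Set.union_eq_left.2 ?_
      rintro w (rfl | rfl)
      exacts [⟨he.right_mem, hyx⟩, ⟨hf.right_mem, hzx⟩]
    have h2 : V(G.deleteVerts {x}).ncard < V(G).ncard :=
      Set.ncard_lt_ncard (by simpa [Set.ssubset_iff_subset_ne] using he.left_mem) hV
    have h3 : E((G.deleteVerts {x}).addEdge d y z).ncard ≤ E(G.deleteVerts {x}).ncard + 1 :=
      (Set.ncard_le_ncard edgeSet_addEdge_subset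
        ((hE.subset deleteVerts_le.edgeSet_mono).insert _)).trans (Set.ncard_insert_le _ _)
    have h4 : E(G.deleteVerts {x}).ncard < E(G).ncard := by
      refine Set.ncard_lt_ncard ⟨deleteVerts_le.edgeSet_mono, fun hsub => ?_⟩ hE
      obtain ⟨a, b, hab⟩ := exists_isLink_of_mem_edgeSet (hsub he.edge_mem)
      obtain ⟨hab, ha, hb⟩ := (deleteVerts_isLink _ _).1 hab
      rcases he.left_eq_or_eq hab with h | h
      exacts [ha h.symm, hb h.symm]
    rw [h1]
    omega
  | @truncate x y D hmul hD hleft =>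
    have hD' : D.Nonempty := by
      rw [Set.nonempty_iff_ne_empty]
      rintro rfl
      simp at hleft
      omega
    obtain ⟨g, hg⟩ := hD'
    have h1 : E(G.deleteEdges D).ncard < E(G).ncard :=
      Set.ncard_lt_ncard ⟨deleteEdges_le.edgeSet_mono, fun hsub =>
        (hsub (IsLink.edge_mem (hD hg))).2 hg⟩ hE
    have h2 : V(G.deleteEdges D) = V(G) := rfl
    rw [h2]
    omega

/-- Reduction steps preserve the existence of cycles avoiding a given set. -/
lemma ReductionStep.hasCycleIn (h : ReductionStep G H) (hV : V(G).Finite) (hE : E(G).Finite)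
    (hc : G.HasCycleIn W) : H.HasCycleIn W := by
  rw [hasCycleIn_iff (hV.subset h.vertexSet_subset)]
  obtain ⟨U, hUW, hU⟩ := hc.exists_isCore
  cases h with
  | @delete x hx hdeg =>
    refine ⟨U, hUW, hU.deleteVerts ?_⟩
    rw [Set.disjoint_singleton_right]
    intro hxU
    have := hU.two_le_deg hE hxU
    omega
  | bypass hdeg hloop hef he hf hd =>
    exact ⟨_, Set.sdiff_subset.trans hUW, isCore_bypass hE hdeg hloop hef he hf hd hU⟩
  | truncate hmul hD hleft => exact ⟨U, hUW, isCore_truncate hD hleft hU⟩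

lemma ReductionStep.hasDisjointCycles (h : ReductionStep G H) (hV : V(G).Finite) {k : ℕ}
    (hc : H.HasDisjointCycles k) : G.HasDisjointCycles k := by
  classical
  cases h with
  | delete hx hdeg => exact hc.of_le deleteVerts_le
  | @bypass x y z e f d hdeg hloop hef he hf hd =>
    rw [hasDisjointCycles_iff]
    obtain ⟨C, hC⟩ := hc
    have hx := fun i => ((C i).isCore.of_bypass hloop hef he hf).1
    -- At most one of the disjoint cycles contains `y`, so only that one is enlarged by `x`.
    refine ⟨fun i => if y ∈ (C i).verts then insert x (C i).verts else (C i).verts, ?_, ?_⟩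
    · intro i j hij
      have hd := hC hij
      have hy : ¬ (y ∈ (C i).verts ∧ y ∈ (C j).verts) := fun h => Set.disjoint_left.1 hd h.1 h.2
      dsimp only
      split_ifs with h1 h2 h2
      · exact absurd ⟨h1, h2⟩ hy
      · exact Set.disjoint_insert_left.2 ⟨hx j, hd⟩
      · exact Set.disjoint_insert_right.2 ⟨hx i, hd⟩
      · exact hd
    · intro i
      dsimp only
      rcases ((C i).isCore.of_bypass hloop hef he hf).2 with h | ⟨h1, -, h2⟩
      · refine (h.hasCycleIn hV).mono ?_
        split_ifs
        exacts [Set.subset_insert _ _, le_rfl]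
      · rw [if_pos h1]
        exact h2.hasCycleIn hV
  | truncate hmul hD hleft => exact hc.of_le deleteEdges_le

lemma ReductionStep.exists_not_hasCycleIn (h : ReductionStep G H) (hV : V(G).Finite) {F : Set α}
    (hF : F.Finite) (hc : ¬ G.HasCycleIn Fᶜ) :
    ∃ F' : Set α, F'.Finite ∧ F'.ncard ≤ F.ncard ∧ ¬ H.HasCycleIn F'ᶜ := by
  cases h with
  | delete hx hdeg => exact ⟨F, hF, le_rfl, fun h => hc (h.of_le deleteVerts_le)⟩
  | @bypass x y z e f d hdeg hloop hef he hf hd =>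
    by_cases hx : x ∈ F
    -- Every cycle whose lift needs `x` passes through `y`, so `y` takes over the role of `x`.
    · refine ⟨insert y (F \ {x}), (hF.sdiff).insert _, ?_, fun h => ?_⟩
      · refine (Set.ncard_insert_le _ _).trans ?_
        rw [Set.ncard_sdiff_singleton_add_one hx hF]
      · obtain ⟨U, hU, hUc⟩ := h.exists_isCore
        obtain ⟨hxU, h | ⟨hy, -⟩⟩ := hUc.of_bypass hloop hef he hf
        · refine hc ((h.hasCycleIn hV).mono fun w hw hwF => hU hw (Or.inr ⟨hwF, ?_⟩))
          rintro rfl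
          exact hxU hw
        · exact hU hy (Or.inl rfl)
    · refine ⟨F, hF, le_rfl, fun h => ?_⟩
      obtain ⟨U, hU, hUc⟩ := h.exists_isCore
      obtain ⟨hxU, h | ⟨-, -, h⟩⟩ := hUc.of_bypass hloop hef he hf
      · exact hc ((h.hasCycleIn hV).mono hU)
      · exact hc ((h.hasCycleIn hV).mono (Set.insert_subset hx hU))
  | truncate hmul hD hleft => exact ⟨F, hF, le_rfl, fun h => hc (h.of_le deleteEdges_le)⟩

lemma vertexSet_subset_of_reduction (h : Relation.ReflTransGen ReductionStep G R) : V(R) ⊆ V(G) := by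
  induction h with
  | refl => exact le_rfl
  | tail _ h ih => exact h.vertexSet_subset.trans ih

lemma edgeSet_finite_of_reduction (h : Relation.ReflTransGen ReductionStep G R)
    (hE : E(G).Finite) : E(R).Finite := by
  induction h with
  | refl => exact hE
  | tail _ h ih => exact h.edgeSet_finite ih

lemma hasCycleIn_of_reduction (h : Relation.ReflTransGen ReductionStep G R)
    (hV : V(G).Finite) (hE : E(G).Finite)
    (hc : G.HasCycleIn W) : R.HasCycleIn W := by
  induction h with
  | refl => exact hc
  | tail h' h ih =>
    exact h.hasCycleIn (hV.subset (vertexSet_subset_of_reduction h'))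
      (edgeSet_finite_of_reduction h' hE) ih

lemma hasDisjointCycles_of_reduction (h : Relation.ReflTransGen ReductionStep G R)
    (hV : V(G).Finite) {k : ℕ}
    (hc : R.HasDisjointCycles k) : G.HasDisjointCycles k := by
  induction h with
  | refl => exact hc
  | tail h' h ih => exact ih (h.hasDisjointCycles (hV.subset (vertexSet_subset_of_reduction h')) hc)

lemma exists_not_hasCycleIn_of_reduction (h : Relation.ReflTransGen ReductionStep G R)
    (hV : V(G).Finite) {F : Set α}
    (hF : F.Finite) (hc : ¬ G.HasCycleIn Fᶜ) :
    ∃ F' : Set α, F'.Finite ∧ F'.ncard ≤ F.ncard ∧ ¬ R.HasCycleIn F'ᶜ := by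
  induction h with
  | refl => exact ⟨F, hF, le_rfl, hc⟩
  | tail h' h ih =>
    obtain ⟨F', h1, h2, h3⟩ := ih
    obtain ⟨F'', h4, h5, h6⟩ :=
      h.exists_not_hasCycleIn (hV.subset (vertexSet_subset_of_reduction h')) h1 h3
    exact ⟨F'', h4, h5.trans h2, h6⟩

lemma exists_isReduced (hV : V(G).Finite) (hE : E(G).Finite) : ∃ R, IsReduced G R := by
  induction hn : V(G).ncard + E(G).ncard using Nat.strong_induction_on generalizing G with
  | _ n ih =>
    by_cases h : ∃ H, ReductionStep G H
    · obtain ⟨H, hH⟩ := h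
      obtain ⟨R, h1, h2⟩ := ih _ (hn ▸ hH.ncard_lt hV hE) (hV.subset hH.vertexSet_subset)
        (hH.edgeSet_finite hE) rfl
      exact ⟨R, Relation.ReflTransGen.head hH h1, h2⟩
    · exact ⟨G, .refl, not_exists.1 h⟩

/-- In an irreducible multigraph without cycles of length at most two every vertex has at least
three neighbours. -/
lemma exists_three_adj (hE : E(R).Finite) (hR : ∀ H, ¬ ReductionStep R H)
    (hg : ∀ C : R.Cycle, 2 < C.len) {x : α} (hx : x ∈ V(R)) :
    ∃ a b c, a ≠ b ∧ a ≠ c ∧ b ≠ c ∧ R.Adj x a ∧ R.Adj x b ∧ R.Adj x c := by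
  have hloop : ∀ l v, ¬ R.IsLoopAt l v := fun l v hl => by
    obtain ⟨C, hC, -⟩ := exists_cycle_of_isLoopAt hl
    have := hg C
    omega
  have hpar : ∀ {e f a b}, R.IsLink e a b → R.IsLink f a b → e = f := by
    intro e f a b he hf
    by_contra hef
    obtain ⟨C, hC, -⟩ := exists_cycle_of_parallel (by rintro rfl; exact hloop _ _ he) hef he hf
    have := hg C
    omega
  have hdeg : R.deg x = {e | R.IsNonloopAt e x}.ncard := by
    simp [deg, hloop]
  have h2 : 2 < R.deg x := by
    by_contra! hle
    rcases Nat.lt_or_ge (R.deg x) 2 with h | h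
    · exact hR _ (.delete hx (by omega))
    · have h2 : R.deg x = 2 := le_antisymm hle h
      obtain ⟨e, f, hef, hset⟩ := Set.ncard_eq_two.1 (hdeg.symm.trans h2)
      have he : e ∈ {e | R.IsNonloopAt e x} := by rw [hset]; simp
      have hf : f ∈ {e | R.IsNonloopAt e x} := by rw [hset]; simp
      obtain ⟨y, hy, he⟩ := he
      obtain ⟨z, hz, hf⟩ := hf
      -- The label `e` is free once `x` is deleted; reusing it means that no fresh element of `β` is
      -- needed.
      refine hR _ (.bypass h2 (fun l => hloop l x) hef he hf (d := e) fun hd => ?_)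
      obtain ⟨a, b, hab⟩ := exists_isLink_of_mem_edgeSet hd
      obtain ⟨hab, ha, hb⟩ := (deleteVerts_isLink _ _).1 hab
      rcases he.left_eq_or_eq hab with h | h
      exacts [ha h.symm, hb h.symm]
  rw [hdeg, Set.two_lt_ncard (hE.subset fun _ h => h.edge_mem)] at h2
  obtain ⟨e, ⟨a, -, ha⟩, f, ⟨b, -, hb⟩, g, ⟨c, -, hc⟩, h1, h2, h3⟩ := h2
  refine ⟨a, b, c, ?_, ?_, ?_, ⟨e, ha⟩, ⟨f, hb⟩, ⟨g, hc⟩⟩ <;> rintro rfl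
  exacts [h1 (hpar ha hb), h2 (hpar ha hc), h3 (hpar hb hc)]

end Graph

/-! ### Non-backtracking walks below half the girth -/

namespace SimpleGraph

variable {V : Type*} {Γ : SimpleGraph V}

/-- No cycle has length at most `l`: a walk joining the ends of an edge without using that edge
has length at least `l`. -/
def NoShortCycle (Γ : SimpleGraph V) (l : ℕ) : Prop :=
  ∀ ⦃a b⦄, Γ.Adj a b → ∀ p : Γ.Walk b a, s(a, b) ∉ p.edges → l ≤ p.length

lemma NoShortCycle.anti {Δ : SimpleGraph V} {l : ℕ} (h : Γ.NoShortCycle l) (hle : Δ ≤ Γ) :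
    Δ.NoShortCycle l := fun a b hab p hp => by
  have := h (hle hab) (p.mapLe hle) (by simpa using hp)
  simpa using this

lemma NoShortCycle.mono {l m : ℕ} (h : Γ.NoShortCycle l) (hlm : m ≤ l) : Γ.NoShortCycle m :=
  fun _ _ hab p hp => hlm.trans (h hab p hp)

/-- A geodesic to `b` cannot contain other vertices at least as far away; this shows that the closed
walks built from geodesics below avoid the edge in question. -/
lemma exists_walk_dist {v b : V} (h : Γ.Reachable v b) :
    ∃ q : Γ.Walk v b, q.length = Γ.dist v b ∧
      ∀ x ∈ q.support, x ≠ b → Γ.dist v x < Γ.dist v b := by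
  classical
  obtain ⟨q, hq⟩ := h.exists_walk_length_eq_dist
  refine ⟨q, hq, fun x hx hxb => ?_⟩
  have h1 := dist_le (q.takeUntil x hx)
  have h2 := congrArg Walk.length (q.take_spec hx)
  rw [Walk.length_append] at h2
  have h3 : (q.dropUntil x hx).length ≠ 0 := fun h0 => hxb (Walk.eq_of_length_eq_zero h0)
  omega

/-- Below half the girth, the predecessor on a geodesic is unique. -/
lemma NoShortCycle.eq_of_dist {t s : ℕ} (h : Γ.NoShortCycle (2 * t)) {v b a a' : V}
    (hs : s + 1 ≤ t) (hb : Γ.dist v b = s + 1) (hr : Γ.Reachable v b) (ha : Γ.Adj a b)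
    (ha' : Γ.Adj a' b)
    (hda : Γ.dist v a = s) (hda' : Γ.dist v a' = s) : a = a' := by
  by_contra hne
  obtain ⟨q, hq, hq2⟩ := exists_walk_dist (hr.trans ha.symm.reachable)
  obtain ⟨q', hq', hq2'⟩ := exists_walk_dist (hr.trans ha'.symm.reachable)
  have h1 : b ∉ q.support := fun hmem => by
    have := hq2 b hmem ha.ne'
    omega
  have h2 : b ∉ q'.support := fun hmem => by
    have := hq2' b hmem ha'.ne'
    omega
  -- The edge to `a'` and the two geodesics form a walk from `b` to `a` of length `2s + 1 < 2t` that
  -- avoids the edge `ab`.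
  have := h ha (Walk.cons ha'.symm (q'.reverse.append q)) (by
    rw [Walk.edges_cons, Walk.edges_append, Walk.edges_reverse, List.mem_cons, List.mem_append,
      List.mem_reverse]
    rintro (h3 | h3 | h3)
    · simp only [Sym2.eq_iff] at h3
      rcases h3 with ⟨h3, -⟩ | ⟨h3, -⟩
      exacts [ha.ne h3, hne h3]
    · exact h2 (q'.snd_mem_support_of_mem_edges h3)
    · exact h1 (q.snd_mem_support_of_mem_edges h3))
  simp at this
  omega

/-- Below half the girth, a non-backtracking walk keeps moving away from its start. -/
lemma NoShortCycle.dist_succ {t s : ℕ} (h : Γ.NoShortCycle (2 * t)) {v b a c : V}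
    (hs : s + 2 ≤ t) (hb : Γ.dist v b = s + 1) (hr : Γ.Reachable v b) (ha : Γ.Adj a b)
    (hda : Γ.dist v a = s) (hc : Γ.Adj b c) (hca : c ≠ a) : Γ.dist v c = s + 2 := by
  have hrc := hr.trans hc.reachable
  rcases hc.diff_dist_adj (u := v) with h1 | h1 | h1
  -- If `c` is as far from `v` as `b`, two geodesics give a walk of length `2(s + 1) < 2t` avoiding
  -- the edge `bc`. If `c` is nearer, it is a second predecessor of `b`.
  · exfalso
    obtain ⟨q, hq, hq2⟩ := exists_walk_dist hr
    obtain ⟨q', hq', hq2'⟩ := exists_walk_dist hrc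
    have := h hc (q'.reverse.append q) (by
      rw [Walk.edges_append, Walk.edges_reverse, List.mem_append, List.mem_reverse]
      rintro (h3 | h3)
      · have := hq2' b (q'.fst_mem_support_of_mem_edges h3) hc.ne
        omega
      · have := hq2 c (q.snd_mem_support_of_mem_edges h3) hc.ne'
        omega)
    simp at this
    omega
  · omega
  · exact absurd (h.eq_of_dist (by omega) hb hr ha hc.symm hda (by omega)) hca.symm

section Count

variable [DecidableEq V] [Fintype V] [DecidableRel Γ.Adj]

variable (Γ) in
/-- The number of non-backtracking walks with `t` further edges that start with the dart `d`. -/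
def nbCount : ℕ → V × V → ℕ
  | 0, _ => 1
  | t + 1, d => ∑ c ∈ (Γ.neighborFinset d.2).erase d.1, nbCount t (d.2, c)

variable (Γ) in
/-- The last darts of the non-backtracking walks with `s` further edges that start with `d`. -/
def nbLevel (d : V × V) : ℕ → Finset (V × V)
  | 0 => {d}
  | s + 1 => (nbLevel d s).biUnion fun e =>
      ((Γ.neighborFinset e.2).erase e.1).image fun c => (e.2, c)

lemma NoShortCycle.nbLevel_spec {t s : ℕ} (h : Γ.NoShortCycle (2 * t)) {u v : V} (huv : Γ.Adj u v)
    (hs : s ≤ t) {e : V × V} (he : e ∈ Γ.nbLevel (u, v) s) :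
    Γ.Reachable v e.2 ∧ Γ.dist v e.2 = s ∧ Γ.Adj e.1 e.2 ∧
      (e = (u, v) ∧ s = 0 ∨ Γ.dist v e.1 + 1 = s) := by
  induction s generalizing e with
  | zero =>
    simp only [nbLevel, Finset.mem_singleton] at he
    subst he
    simp [huv]
  | succ s ih =>
    simp only [nbLevel, Finset.mem_biUnion, Finset.mem_image, Finset.mem_erase,
      mem_neighborFinset] at he
    obtain ⟨⟨a, b⟩, hab, c, ⟨hca, hbc⟩, rfl⟩ := he
    obtain ⟨h1, h2, h3, h4⟩ := ih (by omega) hab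
    simp only at h1 h2 h3 h4 hca hbc ⊢
    refine ⟨h1.trans hbc.reachable, ?_, hbc, Or.inr (by omega)⟩
    rcases h4 with ⟨h4, rfl⟩ | h4
    · have : b = v := by simpa using congrArg Prod.snd h4
      subst this
      simpa using hbc
    · obtain ⟨s, rfl⟩ : ∃ s', s = s' + 1 := ⟨s - 1, by omega⟩
      exact h.dist_succ hs h2 h1 h3 (by omega) hbc hca

lemma NoShortCycle.nbLevel_injOn {t s : ℕ} (h : Γ.NoShortCycle (2 * t)) {u v : V}
    (huv : Γ.Adj u v) (hs : s ≤ t) :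
    Set.InjOn Prod.snd (Γ.nbLevel (u, v) s : Set (V × V)) := by
  rintro ⟨a, b⟩ he ⟨a', b'⟩ he' hbb
  obtain rfl : b = b' := hbb
  obtain ⟨h1, h2, h3, h4⟩ := h.nbLevel_spec huv hs he
  obtain ⟨-, -, h3', h4'⟩ := h.nbLevel_spec huv hs he'
  rcases h4 with ⟨h4, rfl⟩ | h4 <;> rcases h4' with ⟨h4', h5⟩ | h4'
  · exact h4.trans h4'.symm
  · omega
  · omega
  · obtain ⟨s, rfl⟩ : ∃ s', s = s' + 1 := ⟨s - 1, by omega⟩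
    exact Prod.ext (h.eq_of_dist hs h2 h1 h3 h3' (by omega) (by omega)) rfl

/-- Darts of one level have distinct heads, so their sets of continuations are disjoint and the sum
passes unchanged to the next level. At `s = 0` this says that the walks have distinct last darts. -/
lemma NoShortCycle.sum_nbLevel {t s k : ℕ} (h : Γ.NoShortCycle (2 * t)) {u v : V}
    (huv : Γ.Adj u v) (hs : s + k = t) :
    ∑ e ∈ Γ.nbLevel (u, v) s, Γ.nbCount k e = (Γ.nbLevel (u, v) t).card := by
  induction k generalizing s with
  | zero =>
    obtain rfl : s = t := by omega
    simp [nbCount]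
  | succ k ih =>
    rw [← ih (s := s + 1) (by omega), nbLevel, Finset.sum_biUnion]
    · refine Finset.sum_congr rfl fun e _ => ?_
      rw [nbCount, Finset.sum_image]
      intro c _ c' _ hcc
      exact congrArg Prod.snd hcc
    · intro e he e' he' hne
      rw [Function.onFun, Finset.disjoint_left]
      rintro x hx hx'
      obtain ⟨c, -, rfl⟩ := Finset.mem_image.1 hx
      obtain ⟨c', -, hc'⟩ := Finset.mem_image.1 hx'
      exact hne (h.nbLevel_injOn huv (by omega) he he' (congrArg Prod.fst hc').symm)

/-- Non-backtracking walks that are short relative to the girth have distinct ends. -/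
lemma NoShortCycle.nbCount_le {t : ℕ} (h : Γ.NoShortCycle (2 * t)) {u v : V}
    (huv : Γ.Adj u v) {S : Finset V}
    (hS : ∀ x, Γ.Reachable v x → Γ.dist v x ≤ t → x ∈ S) : Γ.nbCount t (u, v) ≤ S.card := by
  have h1 := h.sum_nbLevel huv (s := 0) (k := t) (by omega)
  simp only [nbLevel, Finset.sum_singleton] at h1
  rw [h1, ← Finset.card_image_of_injOn (h.nbLevel_injOn huv le_rfl)]
  refine Finset.card_le_card fun x hx => ?_
  obtain ⟨e, he, rfl⟩ := Finset.mem_image.1 hx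
  obtain ⟨h2, h3, -⟩ := h.nbLevel_spec huv le_rfl he
  exact hS _ h2 h3.le

lemma card_erase_neighborFinset {a b : V} (hab : Γ.Adj a b) :
    ((Γ.neighborFinset b).erase a).card = Γ.degree b - 1 := by
  rw [Finset.card_erase_of_mem (by simpa using hab.symm), card_neighborFinset_eq_degree]

lemma two_pow_le_nbCount (hdeg : ∀ v, 3 ≤ Γ.degree v) (t : ℕ) {a b : V} (hab : Γ.Adj a b) :
    2 ^ t ≤ Γ.nbCount t (a, b) := by
  induction t generalizing a b with
  | zero => simp [nbCount]
  | succ t ih =>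
    rw [nbCount, pow_succ']
    refine le_trans ?_ (Finset.card_nsmul_le_sum _ _ (2 ^ t) fun c hc => ?_)
    · rw [smul_eq_mul, card_erase_neighborFinset hab]
      exact Nat.mul_le_mul_right _ (by have := hdeg b; omega)
    · exact ih (by simpa using (Finset.mem_erase.1 hc).2)

end Count

end SimpleGraph

/-! ### The Moore bound for irregular graphs -/

namespace SimpleGraph

variable {V : Type*} {Γ : SimpleGraph V}

/-- The second derivative is `(x - 2) / (x - 1)^2`. The lemma feeds Jensen's inequality over the
degrees, which is why minimum degree two is treated first. -/
lemma convexOn_mul_log_sub_one :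
    ConvexOn ℝ (Set.Ici 2) fun x : ℝ => x * Real.log (x - 1) := by
  have h1 : ∀ x : ℝ, 2 ≤ x → HasDerivAt (fun x : ℝ => x * Real.log (x - 1))
      (Real.log (x - 1) + x / (x - 1)) x := by
    intro x hx
    have h : HasDerivAt (fun x : ℝ => x * Real.log (x - 1))
        (1 * Real.log (x - 1) + x * (1 / (x - 1))) x :=
      (hasDerivAt_id' x).mul (((hasDerivAt_id' x).sub_const 1).log (by linarith))
    exact h.congr_deriv (by ring)
  have h2 : ∀ x : ℝ, 2 < x → HasDerivAt (fun x : ℝ => Real.log (x - 1) + x / (x - 1))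
      ((x - 2) / (x - 1) ^ 2) x := by
    intro x hx
    have hne : x - 1 ≠ 0 := by linarith
    have h : HasDerivAt (fun x : ℝ => Real.log (x - 1) + x / (x - 1))
        (1 / (x - 1) + (1 * (x - 1) - x * 1) / (x - 1) ^ 2) x :=
      (((hasDerivAt_id' x).sub_const 1).log hne).add
        ((hasDerivAt_id' x).div ((hasDerivAt_id' x).sub_const 1) hne)
    refine h.congr_deriv ?_
    field_simp
    ring
  have h3 : ∀ x : ℝ, 2 < x → deriv (fun x : ℝ => x * Real.log (x - 1)) =ᶠ[nhds x]
      fun x : ℝ => Real.log (x - 1) + x / (x - 1) := fun x hx => by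
    filter_upwards [lt_mem_nhds hx] with y hy using (h1 y hy.le).deriv
  refine convexOn_of_deriv2_nonneg (convex_Ici 2)
    (fun x hx => (h1 x hx).continuousAt.continuousWithinAt) ?_ ?_ ?_ <;> rw [interior_Ici] <;>
    intro x hx
  · exact (h1 x (le_of_lt hx)).differentiableAt.differentiableWithinAt
  · exact ((h3 x hx).differentiableAt_iff.2 (h2 x hx).differentiableAt).differentiableWithinAt
  · have : deriv^[2] (fun x : ℝ => x * Real.log (x - 1)) x = (x - 2) / (x - 1) ^ 2 := by
      simp only [Function.iterate_succ, Function.iterate_zero, Function.comp_apply, id]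
      rw [(h3 x hx).deriv_eq, (h2 x hx).deriv]
    rw [this]
    have : (2 : ℝ) < x := hx
    exact div_nonneg (by linarith) (sq_nonneg _)

section

variable [DecidableEq V] [Fintype V] [DecidableRel Γ.Adj] {U : Finset V}

lemma nbCount_pos (hU : ∀ a b, Γ.Adj a b → a ∈ U) (hdeg : ∀ v ∈ U, 2 ≤ Γ.degree v) (t : ℕ)
    {a b : V} (hab : Γ.Adj a b) : 0 < Γ.nbCount t (a, b) := by
  induction t generalizing a b with
  | zero => simp [nbCount]
  | succ t ih =>
    rw [nbCount]
    refine Finset.sum_pos (fun c hc => ih (by simpa using (Finset.mem_erase.1 hc).2)) ?_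
    rw [← Finset.card_pos, card_erase_neighborFinset hab]
    have := hdeg b (hU b a hab.symm)
    omega

/-- The logarithm of the number of non-backtracking walks, summed over the first dart. -/
lemma mul_sum_le_sum_log_nbCount (hU : ∀ a b, Γ.Adj a b → a ∈ U)
    (hdeg : ∀ v ∈ U, 2 ≤ Γ.degree v) (t : ℕ) :
    t * ∑ b ∈ U, (Γ.degree b : ℝ) * Real.log (Γ.degree b - 1) ≤
      ∑ b ∈ U, ∑ c ∈ Γ.neighborFinset b, Real.log (Γ.nbCount t (b, c)) := by
  have hswap : ∀ g : V → V → ℝ, ∑ a ∈ U, ∑ b ∈ Γ.neighborFinset a, g a b =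
      ∑ b ∈ U, ∑ a ∈ Γ.neighborFinset b, g a b := fun g =>
    Finset.sum_comm' fun a b => by
      simp only [mem_neighborFinset]
      exact ⟨fun h => ⟨h.2.symm, hU _ _ h.2.symm⟩, fun h => ⟨hU _ _ h.1.symm, h.1.symm⟩⟩
  induction t with
  | zero => simp [nbCount]
  | succ t ih =>
    -- The count for `(a, b)` is `deg b - 1` times the average over its continuations; concavity of
    -- the logarithm bounds the logarithm of the average from below.
    have key : ∀ a b, Γ.Adj a b → Real.log (Γ.degree b - 1) +
        ∑ c ∈ (Γ.neighborFinset b).erase a,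
          ((Γ.degree b : ℝ) - 1)⁻¹ * Real.log (Γ.nbCount t (b, c)) ≤
        Real.log (Γ.nbCount (t + 1) (a, b)) := by
      intro a b hab
      rw [← Finset.mul_sum]
      have hd := hdeg b (hU b a hab.symm)
      have hd' : (2 : ℝ) ≤ Γ.degree b := by exact_mod_cast hd
      have hcard : (((Γ.neighborFinset b).erase a).card : ℝ) = (Γ.degree b : ℝ) - 1 := by
        rw [card_erase_neighborFinset hab, Nat.cast_sub (by omega), Nat.cast_one]
      have hpos : ∀ c ∈ (Γ.neighborFinset b).erase a, 0 < Γ.nbCount t (b, c) := fun c hc =>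
        nbCount_pos hU hdeg t (by simpa using (Finset.mem_erase.1 hc).2)
      have h1 := strictConcaveOn_log_Ioi.concaveOn.le_map_sum
        (t := (Γ.neighborFinset b).erase a) (w := fun _ => ((Γ.degree b : ℝ) - 1)⁻¹)
        (p := fun c => (Γ.nbCount t (b, c) : ℝ))
        (fun _ _ => inv_nonneg.2 (by linarith))
        (by rw [Finset.sum_const, nsmul_eq_mul, hcard, mul_inv_cancel₀ (by linarith)])
        (fun c hc => by simpa using hpos c hc)
      simp only [smul_eq_mul] at h1
      rw [← Finset.mul_sum, ← Finset.mul_sum, ← Nat.cast_sum] at h1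
      have h2 : Γ.nbCount (t + 1) (a, b) =
        ∑ c ∈ (Γ.neighborFinset b).erase a, Γ.nbCount t (b, c) := rfl
      rw [← h2, Real.log_mul (by have : (Γ.degree b : ℝ) - 1 > 0 := by linarith
                                 positivity)
        (by have := nbCount_pos hU hdeg (t + 1) hab
            positivity), Real.log_inv] at h1
      linarith
    -- Each dart `(b, c)` continues exactly `deg b - 1` darts into `b`, which cancels the weight:
    -- the uniform distribution on darts is stationary for the non-backtracking walk.
    have hinner : ∀ b ∈ U, ∑ a ∈ Γ.neighborFinset b, ∑ c ∈ (Γ.neighborFinset b).erase a,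
        ((Γ.degree b : ℝ) - 1)⁻¹ * Real.log (Γ.nbCount t (b, c)) =
        ∑ c ∈ Γ.neighborFinset b, Real.log (Γ.nbCount t (b, c)) := by
      intro b hb
      have hd : (2 : ℝ) ≤ Γ.degree b := by exact_mod_cast hdeg b hb
      rw [Finset.sum_comm' (t' := Γ.neighborFinset b)
        (s' := fun c => (Γ.neighborFinset b).erase c) (fun a c => by
          simp only [Finset.mem_erase]
          constructor
          · rintro ⟨h1, h2, h3⟩; exact ⟨⟨h2.symm, h1⟩, h3⟩
          · rintro ⟨⟨h1, h2⟩, h3⟩; exact ⟨h2, h1.symm, h3⟩)]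
      refine Finset.sum_congr rfl fun c hc => ?_
      rw [Finset.sum_const, nsmul_eq_mul, card_erase_neighborFinset
        (by simpa using hc : Γ.Adj b c).symm, Nat.cast_sub (by have := hdeg b hb; omega),
        Nat.cast_one, ← mul_assoc, mul_inv_cancel₀ (by linarith), one_mul]
    calc ((t + 1 : ℕ) : ℝ) * ∑ b ∈ U, (Γ.degree b : ℝ) * Real.log (Γ.degree b - 1)
        ≤ ∑ b ∈ U, (Γ.degree b : ℝ) * Real.log (Γ.degree b - 1) +
          ∑ b ∈ U, ∑ c ∈ Γ.neighborFinset b, Real.log (Γ.nbCount t (b, c)) := by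
          push_cast; linarith
      _ = ∑ b ∈ U, ∑ a ∈ Γ.neighborFinset b, (Real.log (Γ.degree b - 1) +
            ∑ c ∈ (Γ.neighborFinset b).erase a,
              ((Γ.degree b : ℝ) - 1)⁻¹ * Real.log (Γ.nbCount t (b, c))) := by
          rw [← Finset.sum_add_distrib]
          refine Finset.sum_congr rfl fun b hb => ?_
          rw [Finset.sum_add_distrib, hinner b hb, Finset.sum_const, nsmul_eq_mul,
            card_neighborFinset_eq_degree]
      _ ≤ ∑ b ∈ U, ∑ a ∈ Γ.neighborFinset b, Real.log (Γ.nbCount (t + 1) (a, b)) :=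
          Finset.sum_le_sum fun b _ => Finset.sum_le_sum fun a ha =>
            key a b (by simpa using ha : Γ.Adj b a).symm
      _ = _ := (hswap _).symm

/-- The Moore bound of Alon, Hoory and Linial for graphs of minimum degree at least two. -/
lemma NoShortCycle.sum_degree_le_of_two_le {t : ℕ} (h : Γ.NoShortCycle (2 * t)) (ht : 0 < t)
    (hU : ∀ a b, Γ.Adj a b → a ∈ U) (hdeg : ∀ v ∈ U, 2 ≤ Γ.degree v) (hne : U.Nonempty) :
    (∑ v ∈ U, Γ.degree v : ℝ) ≤ (U.card : ℝ) ^ (1 + 1 / (t : ℝ)) + U.card := by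
  set n : ℝ := (U.card : ℝ) with hn
  set D : ℝ := ∑ v ∈ U, (Γ.degree v : ℝ) with hD
  have hn0 : 0 < n := by rw [hn]; exact_mod_cast hne.card_pos
  have ht0 : (0 : ℝ) < t := by exact_mod_cast ht
  have hD2 : 2 * n ≤ D := by
    have := Finset.card_nsmul_le_sum U (fun v => (Γ.degree v : ℝ)) 2
      fun v hv => by exact_mod_cast hdeg v hv
    rw [nsmul_eq_mul] at this
    linarith
  have hD0 : 0 < D := by linarith
  have h1 := mul_sum_le_sum_log_nbCount hU hdeg t
  have h2 : ∑ b ∈ U, ∑ c ∈ Γ.neighborFinset b, Real.log (Γ.nbCount t (b, c)) ≤ D * Real.log n := by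
    rw [hD, Finset.sum_mul]
    refine Finset.sum_le_sum fun b _ => ?_
    rw [← card_neighborFinset_eq_degree, ← nsmul_eq_mul]
    refine Finset.sum_le_card_nsmul _ _ _ fun c hc => ?_
    have hbc : Γ.Adj b c := by simpa using hc
    refine Real.log_le_log (by exact_mod_cast nbCount_pos hU hdeg t hbc) ?_
    rw [hn]
    refine Nat.cast_le.2 (h.nbCount_le hbc fun x hx _ => ?_)
    obtain ⟨p⟩ := hx.symm
    cases p with
    | nil => exact hU _ _ hbc.symm
    | cons hadj _ => exact hU _ _ hadj
  have h3 := convexOn_mul_log_sub_one.map_sum_le (t := U) (w := fun _ => n⁻¹)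
    (p := fun v => (Γ.degree v : ℝ)) (fun _ _ => inv_nonneg.2 hn0.le)
    (by rw [Finset.sum_const, nsmul_eq_mul, ← hn, mul_inv_cancel₀ hn0.ne'])
    (fun v hv => by
      have : (2 : ℝ) ≤ Γ.degree v := by exact_mod_cast hdeg v hv
      exact this)
  simp only [smul_eq_mul] at h3
  rw [← Finset.mul_sum, ← Finset.mul_sum, ← hD] at h3
  -- Jensen replaces all degrees by the average degree `D / n`; with the upper bound `n` on each
  -- walk count this gives `(D / n - 1)^t ≤ n`.
  have h4 : D * Real.log (n⁻¹ * D - 1) ≤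
      ∑ b ∈ U, (Γ.degree b : ℝ) * Real.log (Γ.degree b - 1) := by
    have := mul_le_mul_of_nonneg_left h3 hn0.le
    rw [← mul_assoc, ← mul_assoc, ← mul_assoc, mul_inv_cancel₀ hn0.ne', one_mul, one_mul] at this
    exact this
  have h5 : t * Real.log (n⁻¹ * D - 1) ≤ Real.log n := by
    have : t * (D * Real.log (n⁻¹ * D - 1)) ≤ D * Real.log n :=
      (mul_le_mul_of_nonneg_left h4 ht0.le).trans (h1.trans h2)
    refine le_of_mul_le_mul_left ?_ hD0
    linarith
  have h6 : 1 ≤ n⁻¹ * D - 1 := by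
    have : 2 ≤ n⁻¹ * D := by
      rw [inv_mul_eq_div, le_div_iff₀ hn0]; exact hD2
    linarith
  have h7 : n⁻¹ * D - 1 ≤ n ^ (1 / (t : ℝ)) := by
    rw [← Real.log_le_log_iff (by linarith) (by positivity), Real.log_rpow hn0]
    rw [one_div, le_inv_mul_iff₀ ht0]
    exact h5
  have h8 := mul_le_mul_of_nonneg_left h7 hn0.le
  rw [Real.rpow_add hn0, Real.rpow_one]
  rw [mul_sub, ← mul_assoc, mul_inv_cancel₀ hn0.ne'] at h8
  linarith

end

/-- The Moore bound of Alon, Hoory and Linial for the number of darts. -/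
theorem NoShortCycle.sum_degree_le [DecidableEq V] [Fintype V] [DecidableRel Γ.Adj] {t : ℕ}
    (h : Γ.NoShortCycle (2 * t)) (ht : 0 < t) (U : Finset V) :
    (∑ v ∈ U, (U.filter (Γ.Adj v)).card : ℝ) ≤
      (U.card : ℝ) ^ (1 + 1 / (t : ℝ)) + U.card := by
  classical
  have ht0 : (0 : ℝ) < t := by exact_mod_cast ht
  induction hk : U.card generalizing U with
  | zero =>
    rw [Finset.card_eq_zero] at hk
    subst hk
    rw [Finset.sum_empty]
    positivity
  | succ k ih =>
    have hne : U.Nonempty := Finset.card_pos.1 (by omega)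
    by_cases hdeg : ∀ v ∈ U, 2 ≤ (U.filter (Γ.Adj v)).card
    · let Δ : SimpleGraph V :=
        { Adj := fun a b => Γ.Adj a b ∧ a ∈ U ∧ b ∈ U
          symm := ⟨fun a b h => ⟨h.1.symm, h.2.2, h.2.1⟩⟩
          loopless := ⟨fun a h => h.1.ne rfl⟩ }
      have hΔ : ∀ v ∈ U, Δ.degree v = (U.filter (Γ.Adj v)).card := by
        intro v hv
        rw [← card_neighborFinset_eq_degree]
        congr 1
        ext w
        simp [Δ, hv, and_comm]
      have := NoShortCycle.sum_degree_le_of_two_le (Γ := Δ) (U := U)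
        (h.anti fun a b h => h.1) ht (fun a b h => h.2.1)
        (fun v hv => by rw [hΔ v hv]; exact hdeg v hv) hne
      rw [← hk]
      refine le_trans (le_of_eq ?_) this
      exact Finset.sum_congr rfl fun v hv => by rw [hΔ v hv]
    -- Deleting a vertex of degree at most one loses at most two darts, while the bound drops by at
    -- least two: one from each of its terms.
    · push Not at hdeg
      obtain ⟨w, hw, hw2⟩ := hdeg
      have h1 := ih (U.erase w) (by rw [Finset.card_erase_of_mem hw]; omega)
      have h2 : ∑ v ∈ U, (U.filter (Γ.Adj v)).card =
          ∑ v ∈ U.erase w, ((U.erase w).filter (Γ.Adj v)).card +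
            2 * (U.filter (Γ.Adj w)).card := by
        rw [← Finset.add_sum_erase _ _ hw]
        have h3 : ∀ v ∈ U.erase w, (U.filter (Γ.Adj v)).card =
            ((U.erase w).filter (Γ.Adj v)).card + if Γ.Adj w v then 1 else 0 := by
          intro v _
          nth_rewrite 1 [← Finset.insert_erase hw]
          rw [Finset.filter_insert]
          split_ifs with h4 h5 h5
          · rw [Finset.card_insert_of_notMem (by simp)]
          · exact absurd h4.symm h5
          · exact absurd h5.symm h4
          · rfl
        rw [Finset.sum_congr rfl h3, Finset.sum_add_distrib, ← Finset.card_filter]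
        have h6 : (U.erase w).filter (Γ.Adj w) = U.filter (Γ.Adj w) := by
          ext v
          simp only [Finset.mem_filter, Finset.mem_erase]
          exact ⟨fun h => ⟨h.1.2, h.2⟩, fun h => ⟨⟨h.2.ne', h.1⟩, h.2⟩⟩
        rw [h6]
        ring
      have h3 : (∑ v ∈ U, (U.filter (Γ.Adj v)).card : ℝ) ≤
          (∑ v ∈ U.erase w, ((U.erase w).filter (Γ.Adj v)).card : ℝ) + 2 := by
        have : ∑ v ∈ U, (U.filter (Γ.Adj v)).card ≤
          ∑ v ∈ U.erase w, ((U.erase w).filter (Γ.Adj v)).card + 2 := by omega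
        exact_mod_cast this
      have h4 : (k : ℝ) ^ (1 + 1 / (t : ℝ)) + 1 ≤ ((k + 1 : ℕ) : ℝ) ^ (1 + 1 / (t : ℝ)) := by
        push_cast
        rw [Real.rpow_add' (by positivity) (by positivity),
          Real.rpow_add' (by positivity) (by positivity), Real.rpow_one, Real.rpow_one, add_mul,
          one_mul]
        have h5 : (k : ℝ) ^ (1 / (t : ℝ)) ≤ ((k : ℝ) + 1) ^ (1 / (t : ℝ)) :=
          Real.rpow_le_rpow (by positivity) (by linarith) (by positivity)
        have h6 : 1 ≤ ((k : ℝ) + 1) ^ (1 / (t : ℝ)) :=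
          Real.one_le_rpow (by linarith [Nat.cast_nonneg (α := ℝ) k]) (by positivity)
        exact add_le_add (mul_le_mul_of_nonneg_left h5 (by positivity)) h6
      push_cast at h1 h3 h4 ⊢
      linarith

end SimpleGraph

/-! ### Contracting rooted trees -/

namespace SimpleGraph

variable {V : Type*} {Γ : SimpleGraph V}

/-- A family of rooted trees in `Γ`, which covers the vertices in `carrier`. -/
structure RootedForest (Γ : SimpleGraph V) where
  carrier : Set V
  height : V → ℕ
  parent : V → V
  root : V → V
  root_eq : ∀ v ∈ carrier, height v = 0 → root v = v
  adj_parent : ∀ v ∈ carrier, height v ≠ 0 → Γ.Adj v (parent v)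
  parent_mem : ∀ v ∈ carrier, height v ≠ 0 → parent v ∈ carrier
  height_parent : ∀ v ∈ carrier, height v ≠ 0 → height (parent v) < height v
  root_parent : ∀ v ∈ carrier, height v ≠ 0 → root (parent v) = root v

namespace RootedForest

variable (F : RootedForest Γ)

/-- The dart from `u` to `v` leads from a vertex to its parent. -/
def IsUp (u v : V) : Prop := u ∈ F.carrier ∧ F.height u ≠ 0 ∧ F.parent u = v

/-- The edge `uv` joins two covered vertices and is not a tree edge. -/
structure NonTree (u v : V) : Prop where
  adj : Γ.Adj u v
  left_mem : u ∈ F.carrier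
  right_mem : v ∈ F.carrier
  not_up : ¬ F.IsUp u v
  not_down : ¬ F.IsUp v u

variable {F} in
lemma NonTree.symm {u v : V} (h : F.NonTree u v) : F.NonTree v u :=
  ⟨h.adj.symm, h.right_mem, h.left_mem, h.not_down, h.not_up⟩

/-- The graph obtained by contracting the trees. -/
def minor : SimpleGraph V where
  Adj x y := x ≠ y ∧ ∃ u v, F.NonTree u v ∧ F.root u = x ∧ F.root v = y
  symm := ⟨fun _ _ ⟨h, u, v, huv, hu, hv⟩ => ⟨h.symm, v, u, huv.symm, hv, hu⟩⟩
  loopless := ⟨fun _ h => h.1 rfl⟩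

/-- The walk climbs from parent to parent. Heights drop strictly, and only tree edges are used. -/
lemma exists_walk_root {v : V} (hv : v ∈ F.carrier) :
    ∃ q : Γ.Walk v (F.root v), q.length ≤ F.height v ∧
      (∀ a b, F.NonTree a b → s(a, b) ∉ q.edges) ∧
      ∀ x ∈ q.support, x ∈ F.carrier ∧ F.root x = F.root v := by
  induction hn : F.height v using Nat.strong_induction_on generalizing v with
  | _ n ih =>
    by_cases h0 : F.height v = 0
    · rw [F.root_eq v hv h0]
      refine ⟨.nil, by simp, by simp, ?_⟩
      simp only [Walk.support_nil, List.mem_singleton]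
      rintro x rfl
      exact ⟨hv, F.root_eq x hv h0⟩
    · obtain ⟨q, h1, h2, h3⟩ := ih _ (hn ▸ F.height_parent v hv h0) (F.parent_mem v hv h0) rfl
      have hlt := F.height_parent v hv h0
      have hr := F.root_parent v hv h0
      refine ⟨(Walk.cons (F.adj_parent v hv h0) q).copy rfl hr, ?_, ?_, ?_⟩
      · simp only [Walk.length_copy, Walk.length_cons]
        omega
      · intro a b hab
        simp only [Walk.edges_copy, Walk.edges_cons, List.mem_cons, not_or]
        refine ⟨fun h => ?_, h2 a b hab⟩
        rcases Sym2.eq_iff.1 h with ⟨rfl, rfl⟩ | ⟨rfl, rfl⟩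
        exacts [hab.not_up ⟨hv, h0, rfl⟩, hab.not_down ⟨hv, h0, rfl⟩]
      · intro x hx
        simp only [Walk.support_copy, Walk.support_cons, List.mem_cons] at hx
        rcases hx with rfl | hx
        exacts [⟨hv, rfl⟩, hr ▸ h3 x hx]

lemma exists_walk_of_root_eq {D : ℕ} (hD : ∀ v ∈ F.carrier, F.height v ≤ D) {u v : V}
    (hu : u ∈ F.carrier) (hv : v ∈ F.carrier) (huv : F.root u = F.root v) :
    ∃ q : Γ.Walk u v, q.length ≤ 2 * D ∧ (∀ a b, F.NonTree a b → s(a, b) ∉ q.edges) ∧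
      ∀ x ∈ q.support, x ∈ F.carrier ∧ F.root x = F.root u := by
  obtain ⟨q, h1, h2, h3⟩ := F.exists_walk_root hu
  obtain ⟨q', h1', h2', h3'⟩ := F.exists_walk_root hv
  have hDu := hD u hu
  have hDv := hD v hv
  refine ⟨q.append (q'.reverse.copy huv.symm rfl), ?_, ?_, ?_⟩
  · simp only [Walk.length_append, Walk.length_copy, Walk.length_reverse]
    omega
  · intro a b hab
    simp only [Walk.edges_append, Walk.edges_copy, Walk.edges_reverse, List.mem_append,
      List.mem_reverse, not_or]
    exact ⟨h2 a b hab, h2' a b hab⟩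
  · intro x hx
    simp only [Walk.mem_support_append_iff, Walk.support_copy, Walk.support_reverse,
      List.mem_reverse] at hx
    rcases hx with hx | hx
    · exact h3 x hx
    · rw [huv]; exact h3' x hx

/-- Walks in the minor lift to walks that are not much longer. -/
lemma exists_walk_of_minor_walk {D : ℕ} (hD : ∀ v ∈ F.carrier, F.height v ≤ D) {u₀ v₀ : V}
    (h₀ : F.NonTree u₀ v₀) {x y : V} (P : F.minor.Walk x y)
    (hP : s(F.root u₀, F.root v₀) ∉ P.edges) {u v : V} (hu : u ∈ F.carrier) (hv : v ∈ F.carrier)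
    (hux : F.root u = x) (hvy : F.root v = y) :
    ∃ q : Γ.Walk u v, q.length ≤ 2 * D + (2 * D + 1) * P.length ∧ s(u₀, v₀) ∉ q.edges ∧
      ∀ w ∈ q.support, w ∈ F.carrier ∧ F.root w ∈ P.support := by
  induction P generalizing u with
  | nil =>
    obtain ⟨q, h1, h2, h3⟩ := F.exists_walk_of_root_eq hD hu hv (hux.trans hvy.symm)
    refine ⟨q, by simpa using h1, h2 _ _ h₀, fun w hw => ⟨(h3 w hw).1, ?_⟩⟩
    rw [(h3 w hw).2, hux]
    simp
  | @cons x x' y h P ih =>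
    have hadj := h
    obtain ⟨-, u₁, v₁, h₁, hu₁, hv₁⟩ := hadj
    simp only [Walk.edges_cons, List.mem_cons, not_or] at hP
    obtain ⟨q', h1', h2', h3'⟩ := ih hP.2 h₁.right_mem hv₁ hvy
    obtain ⟨q, h1, h2, h3⟩ := F.exists_walk_of_root_eq hD hu h₁.left_mem (hux.trans hu₁.symm)
    refine ⟨q.append (Walk.cons h₁.adj q'), ?_, ?_, ?_⟩
    · simp only [Walk.length_append, Walk.length_cons]
      nlinarith
    · simp only [Walk.edges_append, Walk.edges_cons, List.mem_append, List.mem_cons, not_or]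
      -- Equal edges have equal images under `root`, so if the lifted edge were `u₀v₀`, its image
      -- would lie on the walk in the minor.
      refine ⟨h2 _ _ h₀, fun h => hP.1 ?_, h2'⟩
      have := congrArg (Sym2.map F.root) h
      simpa [hu₁, hv₁] using this
    · intro w hw
      simp only [Walk.mem_support_append_iff, Walk.support_cons, List.mem_cons] at hw ⊢
      rcases hw with hw | rfl | hw
      · exact ⟨(h3 w hw).1, Or.inl ((h3 w hw).2.trans hux)⟩
      · exact ⟨h₁.left_mem, Or.inl hu₁⟩
      · exact ⟨(h3' w hw).1, Or.inr (h3' w hw).2⟩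

/-- A cycle of length `n` in the minor lifts to one of length at most `(2D + 1) n`: `n` non-tree
edges and `n` passages through trees. -/
lemma noShortCycle_minor {D l m : ℕ} (hD : ∀ v ∈ F.carrier, F.height v ≤ D)
    (h : Γ.NoShortCycle l) (hl : (2 * D + 1) * m ≤ l) : F.minor.NoShortCycle m := by
  rintro x y ⟨-, u, v, huv, rfl, rfl⟩ P hP
  obtain ⟨q, h1, h2, -⟩ := F.exists_walk_of_minor_walk hD huv P hP huv.right_mem huv.left_mem rfl rfl
  have h3 := h huv.adj q h2
  by_contra! hlt
  have : (2 * D + 1) * (P.length + 1) ≤ (2 * D + 1) * m := Nat.mul_le_mul_left _ hlt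
  rw [mul_add, mul_one] at this
  omega

/-- A non-tree edge inside one tree would close a cycle of length at most `2D + 1`. -/
lemma NonTree.root_ne {D : ℕ} {F : RootedForest Γ} (hD : ∀ v ∈ F.carrier, F.height v ≤ D)
    (h : Γ.NoShortCycle (4 * D + 2)) {u v : V} (huv : F.NonTree u v) : F.root u ≠ F.root v := by
  intro heq
  obtain ⟨q, h1, h2, -⟩ := F.exists_walk_of_root_eq hD huv.right_mem huv.left_mem heq.symm
  have := h huv.adj q (h2 _ _ huv)
  omega

/-- Large girth makes the non-tree edge between two trees unique. -/
lemma NonTree.eq_of_root_eq {D : ℕ} {F : RootedForest Γ} (hD : ∀ v ∈ F.carrier, F.height v ≤ D)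
    (h : Γ.NoShortCycle (4 * D + 2)) {u v u' v' : V} (huv : F.NonTree u v) (huv' : F.NonTree u' v')
    (hu : F.root u = F.root u') (hv : F.root v = F.root v') : u = u' ∧ v = v' := by
  by_cases hs : s(u, v) = s(u', v')
  · rcases Sym2.eq_iff.1 hs with h1 | ⟨rfl, rfl⟩
    · exact h1
    · exact absurd hu (huv.root_ne hD h)
  · exfalso
    obtain ⟨q, h1, h2, -⟩ := F.exists_walk_of_root_eq hD huv.right_mem huv'.right_mem hv
    obtain ⟨q', h1', h2', -⟩ := F.exists_walk_of_root_eq hD huv'.left_mem huv.left_mem hu.symm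
    -- Two non-tree edges between the same trees close a cycle of length at most `2D + 1 + 2D + 1`.
    have := h huv.adj (q.append (Walk.cons huv'.adj.symm q')) (by
      simp only [Walk.edges_append, Walk.edges_cons, List.mem_append, List.mem_cons, not_or]
      refine ⟨h2 _ _ huv, fun h => hs (h.trans Sym2.eq_swap), h2' _ _ huv⟩)
    simp only [Walk.length_append, Walk.length_cons] at this
    omega

open Classical in
/-- The minor keeps all darts except for those in the trees. -/
lemma card_darts_le [Fintype V] {D : ℕ} (hD : ∀ v ∈ F.carrier, F.height v ≤ D)
    (h : Γ.NoShortCycle (4 * D + 2)) (X Y : Finset V) (hY : ∀ v ∈ F.carrier, F.root v ∈ Y) :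
    ∑ u with u ∈ F.carrier ∧ F.root u ∈ X,
        (Finset.univ.filter fun v => v ∈ F.carrier ∧ Γ.Adj u v).card ≤
      ∑ x ∈ X, (Y.filter (F.minor.Adj x)).card +
        2 * (Finset.univ.filter fun v => v ∈ F.carrier ∧ F.root v ∈ X ∧ F.height v ≠ 0).card := by
  set S := Finset.univ.filter fun v => v ∈ F.carrier ∧ F.root v ∈ X ∧ F.height v ≠ 0
  set N := Finset.univ.filter fun d : (_ : V) × V => F.NonTree d.1 d.2 ∧ F.root d.1 ∈ X
  have h1 : N.card ≤ ∑ x ∈ X, (Y.filter (F.minor.Adj x)).card := by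
    rw [← Finset.card_sigma]
    refine Finset.card_le_card_of_injOn (fun d => ⟨F.root d.1, F.root d.2⟩) ?_ ?_
    · intro d hd
      obtain ⟨-, hd, hdX⟩ := Finset.mem_filter.1 hd
      refine Finset.mem_sigma.2 ⟨hdX, Finset.mem_filter.2 ⟨hY _ hd.right_mem, ?_⟩⟩
      exact ⟨hd.root_ne hD h, _, _, hd, rfl, rfl⟩
    · intro d hd d' hd' heq
      obtain ⟨-, hd, -⟩ := Finset.mem_filter.1 hd
      obtain ⟨-, hd', -⟩ := Finset.mem_filter.1 hd'
      simp only [Sigma.mk.injEq, heq_eq_eq] at heq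
      obtain ⟨h1, h2⟩ := hd.eq_of_root_eq hD h hd' heq.1 heq.2
      exact Sigma.ext h1 (heq_of_eq h2)
  rw [← Finset.card_sigma]
  -- Non-tree darts inject into the darts of the minor; each vertex that is not a root accounts for
  -- the two darts of its parent edge.
  refine (Finset.card_le_card (t := N ∪ (S.image fun v => (⟨v, F.parent v⟩ : (_ : V) × V)) ∪
    (S.image fun v => (⟨F.parent v, v⟩ : (_ : V) × V))) ?_).trans ?_
  · rintro ⟨u, v⟩ hd
    obtain ⟨⟨hu, huX⟩, hv, huv⟩ : (u ∈ F.carrier ∧ F.root u ∈ X) ∧ v ∈ F.carrier ∧ Γ.Adj u v := by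
      simpa using hd
    simp only [Finset.mem_union, Finset.mem_image, N, S, Finset.mem_filter, Finset.mem_univ,
      true_and, Sigma.mk.injEq, heq_eq_eq]
    by_cases h2 : F.IsUp u v
    · exact Or.inl (Or.inr ⟨u, ⟨hu, huX, h2.2.1⟩, rfl, h2.2.2⟩)
    by_cases h3 : F.IsUp v u
    · refine Or.inr ⟨v, ⟨hv, ?_, h3.2.1⟩, h3.2.2, rfl⟩
      rw [← F.root_parent v hv h3.2.1, h3.2.2]
      exact huX
    · exact Or.inl (Or.inl ⟨⟨huv, hu, hv, h2, h3⟩, huX⟩)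
  · refine (Finset.card_union_le _ _).trans ?_
    have h2 := Finset.card_union_le N (S.image fun v => (⟨v, F.parent v⟩ : (_ : V) × V))
    have h3 : (S.image fun v => (⟨v, F.parent v⟩ : (_ : V) × V)).card ≤ S.card := Finset.card_image_le
    have h4 : (S.image fun v => (⟨F.parent v, v⟩ : (_ : V) × V)).card ≤ S.card := Finset.card_image_le
    omega

end RootedForest

end SimpleGraph

/-! ### Vertices outside a feedback vertex set -/

namespace SimpleGraph

variable {V : Type*} {Γ : SimpleGraph V}

open Classical in
/-- Every vertex with a neighbour in `A` is attached to one of these neighbours. -/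
noncomputable def starForest (Γ : SimpleGraph V) (A : Set V) : RootedForest Γ where
  carrier := {v | v ∈ A ∨ ∃ w ∈ A, Γ.Adj v w}
  height v := if v ∈ A then 0 else 1
  parent v := if h : ∃ w ∈ A, Γ.Adj v w then h.choose else v
  root v := if v ∈ A then v else if h : ∃ w ∈ A, Γ.Adj v w then h.choose else v
  root_eq v hv h := by
    by_cases hA : v ∈ A <;> simp_all
  adj_parent v hv h := by
    have hA : v ∉ A := fun hA => h (by simp [hA])
    have h1 := hv.resolve_left hA
    rw [dif_pos h1]
    exact h1.choose_spec.2
  parent_mem v hv h := by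
    have hA : v ∉ A := fun hA => h (by simp [hA])
    have h1 := hv.resolve_left hA
    rw [dif_pos h1]
    exact Or.inl h1.choose_spec.1
  height_parent v hv h := by
    have hA : v ∉ A := fun hA => h (by simp [hA])
    have h1 := hv.resolve_left hA
    rw [dif_pos h1, if_pos h1.choose_spec.1, if_neg hA]
    exact one_pos
  root_parent v hv h := by
    have hA : v ∉ A := fun hA => h (by simp [hA])
    have h1 := hv.resolve_left hA
    rw [dif_pos h1, if_pos h1.choose_spec.1, if_neg hA]

lemma root_starForest_mem {A : Set V} {v : V} (hv : v ∈ (Γ.starForest A).carrier) :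
    (Γ.starForest A).root v ∈ A := by
  by_cases hA : v ∈ A
  · simp [starForest, hA]
  · have h1 := Or.resolve_left hv hA
    simp only [starForest, hA, if_false]
    rw [dif_pos h1]
    exact h1.choose_spec.1

open Classical in
/-- If deleting `A` from a graph of minimum degree three leaves a forest, then the size of the
forest is bounded by the number of edges of the graph obtained by contracting stars
centred at `A`. -/
lemma two_mul_card_compl_le [Fintype V]
    (hdeg : ∀ v, 3 ≤ Γ.degree v) (h : Γ.NoShortCycle 6) (A : Finset V)
    (hA : ∑ v ∈ Aᶜ, (Aᶜ.filter (Γ.Adj v)).card ≤ 2 * Aᶜ.card) :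
    2 * Aᶜ.card ≤ 3 * ∑ x ∈ A, (A.filter ((Γ.starForest (A : Set V)).minor.Adj x)).card := by
  set F := Γ.starForest (A : Set V) with hF
  set B := Aᶜ.filter fun v => ∃ w ∈ A, Γ.Adj v w with hB
  set Q := Aᶜ.filter fun v => ¬ ∃ w ∈ A, Γ.Adj v w with hQ
  have hBQ : Disjoint B Q := Finset.disjoint_filter_filter_not _ _ _
  have hBQu : B ∪ Q = Aᶜ := Finset.filter_union_filter_not_eq _ _
  have hAB : Disjoint A B := Finset.disjoint_left.2 fun v hv hv' =>
    Finset.mem_compl.1 (Finset.mem_filter.1 hv').1 hv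
  let d : Finset V → Finset V → ℕ := fun X Y => ∑ v ∈ X, (Y.filter (Γ.Adj v)).card
  have hl : ∀ {X Y Z : Finset V}, Disjoint X Y → d (X ∪ Y) Z = d X Z + d Y Z := fun hXY =>
    Finset.sum_union hXY
  have hr : ∀ {X Y Z : Finset V}, Disjoint X Y → d Z (X ∪ Y) = d Z X + d Z Y := by
    intro X Y Z hXY
    simp only [d]
    rw [← Finset.sum_add_distrib]
    refine Finset.sum_congr rfl fun v _ => ?_
    rw [Finset.filter_union, Finset.card_union_of_disjoint (Finset.disjoint_filter_filter hXY)]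
  have hsymm : ∀ X Y : Finset V, d X Y = d Y X := by
    intro X Y
    have := Finset.sum_card_bipartiteAbove_eq_sum_card_bipartiteBelow (s := X) (t := Y) Γ.Adj
    simp only [Finset.bipartiteAbove, Finset.bipartiteBelow] at this
    simp only [d, this, Γ.adj_comm]
  have hcard : Aᶜ.card = B.card + Q.card := by
    rw [← hBQu, Finset.card_union_of_disjoint hBQ]
  have hforest : d B B + 2 * d B Q + d Q Q ≤ 2 * (B.card + Q.card) := by
    rw [← hcard]
    refine le_trans (le_of_eq ?_) hA
    change _ = d Aᶜ Aᶜ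
    rw [← hBQu, hl hBQ, hr hBQ, hr hBQ, hsymm Q B]
    ring
  have hdegsum : ∀ X : Finset V, 3 * X.card ≤ d X A + d X B + d X Q := by
    intro X
    rw [add_assoc, ← hr hBQ, hBQu, ← hr disjoint_compl_right, Finset.union_compl, mul_comm,
      ← smul_eq_mul]
    refine Finset.card_nsmul_le_sum _ _ _ fun v _ => ?_
    rw [← neighborFinset_eq_filter, card_neighborFinset_eq_degree]
    exact hdeg v
  have hQA : d Q A = 0 := by
    refine Finset.sum_eq_zero fun v hv => ?_
    rw [Finset.card_eq_zero, Finset.filter_eq_empty_iff]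
    intro w hw hvw
    exact (Finset.mem_filter.1 hv).2 ⟨w, hw, hvw⟩
  have h1 := hdegsum B
  have h2 := hdegsum Q
  rw [hsymm Q B] at h2
  have hD : ∀ v ∈ F.carrier, F.height v ≤ 1 := fun v _ => by
    simp only [hF, starForest]
    split_ifs <;> omega
  have hcar : ∀ v, v ∈ F.carrier ↔ v ∈ A ∪ B := by
    intro v
    simp only [hF, starForest, hB, Finset.mem_union, Finset.mem_filter, Finset.mem_compl,
      Set.mem_ofPred_eq, Finset.mem_coe]
    tauto
  have hroot : ∀ v ∈ F.carrier, F.root v ∈ A := fun v hv => root_starForest_mem hv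
  have h3 := F.card_darts_le hD h A A hroot
  have h4 : (Finset.univ.filter fun u => u ∈ F.carrier ∧ F.root u ∈ A) = A ∪ B := by
    ext v
    simp only [Finset.mem_filter, Finset.mem_univ, true_and, ← hcar]
    exact ⟨fun h => h.1, fun h => ⟨h, hroot v h⟩⟩
  have h5 : (Finset.univ.filter fun u => u ∈ F.carrier ∧ F.root u ∈ A ∧ F.height u ≠ 0) = B := by
    ext v
    simp only [Finset.mem_filter, Finset.mem_univ, true_and]
    constructor
    · rintro ⟨hv, -, h0⟩
      refine (Finset.mem_union.1 ((hcar v).1 hv)).resolve_left fun hvA => h0 ?_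
      simp [hF, starForest, hvA]
    · intro hv
      have hv' := (hcar v).2 (Finset.mem_union_right _ hv)
      have hvA : v ∉ A := fun hvA => Finset.disjoint_left.1 hAB hvA hv
      exact ⟨hv', hroot v hv', by simp [hF, starForest, hvA]⟩
  have h6 : ∀ u, (Finset.univ.filter fun v => v ∈ F.carrier ∧ Γ.Adj u v) =
      (A ∪ B).filter (Γ.Adj u) := by
    intro u
    ext v
    simp [hcar]
  have h7 : d (A ∪ B) (A ∪ B) ≤
      ∑ x ∈ A, (A.filter (F.minor.Adj x)).card + 2 * B.card := by
    rw [h4, h5] at h3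
    simpa only [h6] using h3
  rw [hl hAB, hr hAB, hr hAB, hsymm A B] at h7
  -- With `M` the number of darts of the minor, the star inequality, the degree sum over `B` and the
  -- forest bound give `M ≥ 2|B| - 2|Q| + d Q Q`. The forest bound and the degree sum over `Q` give
  -- `d Q Q ≥ 4|Q| - 2|B|`, hence also `M ≥ 2|Q|`. Adding the first bound to twice the last yields
  -- `3M ≥ 2|B| + 2|Q|`.
  omega

open Classical in
/-- The size of a graph of minimum degree at least three and girth larger than `g` from which the
deletion of `A` leaves a forest is bounded in terms of the size of `A`. -/
theorem card_le_of_forest [Fintype V]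
    (hdeg : ∀ v, 3 ≤ Γ.degree v) {g : ℕ} (hg : 6 < g) (h : Γ.NoShortCycle g) (A : Finset V)
    (hA : ∑ v ∈ Aᶜ, (Aᶜ.filter (Γ.Adj v)).card ≤ 2 * Aᶜ.card) {B : ℝ} (hB : (A.card : ℝ) ≤ B) :
    (Fintype.card V : ℝ) ≤ (2 * B) ^ (1 + 6 / ((g : ℝ) - 6)) + 3 * B := by
  set F := Γ.starForest (A : Set V) with hF
  -- The divisor 6 is `3 * 2`: stars cost a factor `2 * 1 + 1` of the girth, and the Moore bound
  -- needs girth above `2t`.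
  have ht : 0 < g / 6 := Nat.div_pos hg.le (by norm_num)
  have ht0 : (0 : ℝ) < (g / 6 : ℕ) := by exact_mod_cast ht
  have h1 := two_mul_card_compl_le hdeg (h.mono hg.le) A hA
  have hD : ∀ v ∈ F.carrier, F.height v ≤ 1 := fun v _ => by
    simp only [hF, starForest]
    split_ifs <;> omega
  have h2 := (F.noShortCycle_minor (m := 2 * (g / 6)) hD h (by omega)).sum_degree_le ht A
  have h3 : 2 * (Aᶜ.card : ℝ) ≤ 3 * ((A.card : ℝ) ^ (1 + 1 / ((g / 6 : ℕ) : ℝ)) + A.card) := by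
    have : (2 * Aᶜ.card : ℝ) ≤ 3 * ∑ x ∈ A, (A.filter (F.minor.Adj x)).card := by
      exact_mod_cast h1
    push_cast at this
    linarith
  have hcard : (Fintype.card V : ℝ) = A.card + Aᶜ.card := by
    rw [← Nat.cast_add, Finset.card_add_card_compl]
  have hg6 : (0 : ℝ) < (g : ℝ) - 6 := by
    have : (6 : ℝ) < g := by exact_mod_cast hg
    linarith
  have hexp : 1 + 1 / ((g / 6 : ℕ) : ℝ) ≤ 1 + 6 / ((g : ℝ) - 6) := by
    gcongr 1 + ?_
    rw [div_le_div_iff₀ ht0 hg6]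
    have : g < 6 * (g / 6) + 6 := by omega
    have : (g : ℝ) < 6 * (g / 6 : ℕ) + 6 := by exact_mod_cast this
    linarith
  have hB0 : 0 ≤ B := (Nat.cast_nonneg _).trans hB
  have h4 : (A.card : ℝ) ^ (1 + 1 / ((g / 6 : ℕ) : ℝ)) ≤ B ^ (1 + 6 / ((g : ℝ) - 6)) := by
    -- Raising the exponent is monotone only for base at least 1, so an empty `A` is separate.
    rcases Nat.eq_zero_or_pos A.card with h0 | h0
    · rw [h0, Nat.cast_zero, Real.zero_rpow (by positivity)]
      positivity
    · have h1A : (1 : ℝ) ≤ A.card := by exact_mod_cast h0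
      calc _ ≤ (A.card : ℝ) ^ (1 + 6 / ((g : ℝ) - 6)) := Real.rpow_le_rpow_of_exponent_le h1A hexp
        _ ≤ _ := Real.rpow_le_rpow (by positivity) hB (by positivity)
  have h5 : 2 * B ^ (1 + 6 / ((g : ℝ) - 6)) ≤ (2 * B) ^ (1 + 6 / ((g : ℝ) - 6)) := by
    rw [Real.mul_rpow (by norm_num) hB0]
    gcongr
    exact Real.self_le_rpow_of_one_le (by norm_num) (by linarith [div_pos (by norm_num : (0:ℝ) < 6) hg6])
  have h6 : 0 ≤ B ^ (1 + 6 / ((g : ℝ) - 6)) := by positivity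
  rw [hcard]
  linarith

end SimpleGraph

/-! ### Disjoint cycles from large minimum degree -/

namespace SimpleGraph

variable {V : Type*} {Γ : SimpleGraph V}

open Classical in
/-- The number of darts of the subgraph induced by `U`. -/
noncomputable def inducedDarts (Γ : SimpleGraph V) (U : Finset V) : ℕ :=
  ∑ v ∈ U, (U.filter (Γ.Adj v)).card

open Classical in
lemma inducedDarts_insert {U : Finset V} {w : V} (hw : w ∉ U) :
    Γ.inducedDarts (insert w U) = Γ.inducedDarts U + 2 * (U.filter (Γ.Adj w)).card := by
  have h1 : ∀ v ∈ U, ((insert w U).filter (Γ.Adj v)).card =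
      (U.filter (Γ.Adj v)).card + if Γ.Adj w v then 1 else 0 := by
    intro v _
    rw [Finset.filter_insert]
    split_ifs with h4 h5 h5
    · rw [Finset.card_insert_of_notMem (by simp [hw])]
    · exact absurd h4.symm h5
    · exact absurd h5.symm h4
    · rfl
  rw [inducedDarts, Finset.sum_insert hw, Finset.sum_congr rfl h1, Finset.sum_add_distrib,
    ← Finset.card_filter, Finset.filter_insert, if_neg (Γ.irrefl), inducedDarts]
  ring

open Classical in
lemma inducedDarts_erase {U : Finset V} {w : V} (hw : w ∈ U) :
    Γ.inducedDarts U = Γ.inducedDarts (U.erase w) + 2 * (U.filter (Γ.Adj w)).card := by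
  conv_lhs => rw [← Finset.insert_erase hw]
  rw [inducedDarts_insert (Finset.notMem_erase w U)]
  congr 3
  ext v
  simp only [Finset.mem_filter, Finset.mem_erase]
  exact ⟨fun h => ⟨h.1.2, h.2⟩, fun h => ⟨⟨h.2.ne', h.1⟩, h.2⟩⟩

-- Parity improves fewer than `2m` darts to at most `2m - 2`, which the minimality argument needs.
open Classical in
lemma even_inducedDarts (U : Finset V) : Even (Γ.inducedDarts U) := by
  induction U using Finset.induction_on with
  | empty => simp [inducedDarts]
  | insert w U hw ih =>
    rw [inducedDarts_insert hw]
    exact ih.add (even_two_mul _)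

open Classical in
/-- A smallest nonempty set that induces at least as many edges as vertices induces a cycle, and
every other vertex has at most four neighbours on it. -/
lemma card_filter_le_of_minimal {U X : Finset V} (hne : U.Nonempty) (hUX : U ⊆ X)
    (hU : 2 * U.card ≤ Γ.inducedDarts U)
    (hmin : ∀ U' ⊆ X, U'.Nonempty → U'.card < U.card → Γ.inducedDarts U' < 2 * U'.card) :
    ∀ v ∈ X, (U.filter (Γ.Adj v)).card ≤ 4 := by
  have hle : ∀ v ∈ U, (U.filter (Γ.Adj v)).card ≤ U.card - 1 := by
    intro v hv
    rw [← Finset.card_erase_of_mem hv]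
    refine Finset.card_le_card fun w hw => ?_
    obtain ⟨hw, hvw⟩ := Finset.mem_filter.1 hw
    exact Finset.mem_erase.2 ⟨hvw.ne', hw⟩
  have hpos := hne.card_pos
  have h3 : 3 ≤ U.card := by
    have h1 := Finset.sum_le_card_nsmul U _ _ hle
    rw [smul_eq_mul] at h1
    have h2 : 2 * U.card ≤ U.card * (U.card - 1) := hU.trans h1
    by_contra! hlt
    interval_cases U.card <;> omega
  -- `τ` is the excess of edges over vertices. Minimality forces all degrees to be at least `τ + 2`;
  -- summing gives `τ (|U| - 2) ≤ 0`, so `τ = 0` and all degrees equal two.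
  obtain ⟨τ, hτ⟩ : ∃ τ, Γ.inducedDarts U = 2 * U.card + 2 * τ := by
    obtain ⟨m, hm⟩ := Γ.even_inducedDarts U
    exact ⟨m - U.card, by omega⟩
  have hdeg : ∀ w ∈ U, τ + 2 ≤ (U.filter (Γ.Adj w)).card := by
    intro w hw
    have hc := Finset.card_erase_of_mem hw
    have h1 := hmin (U.erase w) ((Finset.erase_subset _ _).trans hUX) (Finset.card_pos.1 (by omega)) (by omega)
    have h2 := inducedDarts_erase (Γ := Γ) hw
    obtain ⟨m, hm⟩ := Γ.even_inducedDarts (U.erase w)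
    omega
  have hτ0 : τ = 0 := by
    have h1 := Finset.card_nsmul_le_sum U _ _ hdeg
    rw [smul_eq_mul] at h1
    have h2 : U.card * (τ + 2) ≤ 2 * U.card + 2 * τ := h1.trans hτ.le
    nlinarith
  subst hτ0
  have hdeg2 : ∀ w ∈ U, (U.filter (Γ.Adj w)).card = 2 := by
    have h1 := (Finset.sum_eq_sum_iff_of_le (f := fun _ => 2) hdeg).1 (by
      rw [Finset.sum_const, smul_eq_mul, mul_comm]
      exact hτ.symm)
    exact fun w hw => (h1 w hw).symm
  intro v hvX
  by_contra! hv
  have hvU : v ∉ U := fun h => by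
    have := hdeg2 v h
    omega
  -- Trading two vertices of `U` for `v` loses at most four edges and gains at least three, so the
  -- smaller set still has as many edges as vertices.
  obtain ⟨w₁, hw₁⟩ := hne
  have hc₁ := Finset.card_erase_of_mem hw₁
  obtain ⟨w₂, hw₂⟩ := Finset.card_pos.1 (by omega : 0 < (U.erase w₁).card)
  have hc₂ := Finset.card_erase_of_mem hw₂
  set U' := (U.erase w₁).erase w₂ with hU'
  have hv' : v ∉ U' := fun h => hvU (Finset.mem_of_mem_erase (Finset.mem_of_mem_erase h))
  have h1 := inducedDarts_erase (Γ := Γ) hw₁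
  have h2 := inducedDarts_erase (Γ := Γ) hw₂
  rw [← hU'] at h2
  have h3' := inducedDarts_insert (Γ := Γ) hv'
  have h4 : ((U.erase w₁).filter (Γ.Adj w₂)).card ≤ 2 := by
    rw [← hdeg2 w₂ (Finset.mem_of_mem_erase hw₂)]
    exact Finset.card_le_card (Finset.filter_subset_filter _ (Finset.erase_subset _ _))
  have h5 : (U.filter (Γ.Adj v)).card ≤ (U'.filter (Γ.Adj v)).card + 2 := by
    rw [hU', Finset.filter_erase, Finset.filter_erase]
    have := Finset.pred_card_le_card_erase (s := U.filter (Γ.Adj v)) (a := w₁)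
    have := Finset.pred_card_le_card_erase (s := (U.filter (Γ.Adj v)).erase w₁) (a := w₂)
    omega
  have h6 := hdeg2 w₁ hw₁
  have hc₃ := Finset.card_insert_of_notMem hv'
  have := hmin (insert v U') (Finset.insert_subset hvX (((Finset.erase_subset _ _).trans
    (Finset.erase_subset _ _)).trans hUX)) (Finset.insert_nonempty _ _) (by omega)
  omega

open Classical in
/-- A graph of large minimum degree contains many disjoint sets that induce cycles. -/
lemma exists_disjoint_of_le_degree (k : ℕ) {X : Finset V} (hX : X.Nonempty)
    (hdeg : ∀ x ∈ X, 5 * k ≤ (X.filter (Γ.Adj x)).card) :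
    ∃ U : Fin k → Finset V, (Pairwise fun i j => Disjoint (U i) (U j)) ∧
      ∀ i, U i ⊆ X ∧ (U i).Nonempty ∧ 2 * (U i).card ≤ Γ.inducedDarts (U i) := by
  induction k generalizing X with
  | zero => exact ⟨Fin.elim0, fun i => i.elim0, fun i => i.elim0⟩
  | succ k ih =>
    have hXd : 2 * X.card ≤ Γ.inducedDarts X := by
      have := Finset.card_nsmul_le_sum X _ _ hdeg
      rw [smul_eq_mul] at this
      change _ ≤ Γ.inducedDarts X at this
      nlinarith
    obtain ⟨U, hU, hUmin⟩ := Finset.exists_min_image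
      (X.powerset.filter fun U => U.Nonempty ∧ 2 * U.card ≤ Γ.inducedDarts U) Finset.card
      ⟨X, by simp [hX, hXd]⟩
    simp only [Finset.mem_filter, Finset.mem_powerset] at hU hUmin
    obtain ⟨hUX, hne, hUd⟩ := hU
    have hU4 := card_filter_le_of_minimal hne hUX hUd (fun U' hsub hne' hlt => by
      by_contra! hge
      have := hUmin U' ⟨hsub, hne', hge⟩
      omega)
    have hsplit : ∀ v ∈ X, (X.filter (Γ.Adj v)).card ≤ ((X \ U).filter (Γ.Adj v)).card + 4 := by
      intro v hv
      refine le_trans ?_ (Nat.add_le_add_left (hU4 v hv) _)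
      rw [← Finset.card_union_of_disjoint (Finset.disjoint_filter_filter Finset.sdiff_disjoint),
        ← Finset.filter_union, Finset.sdiff_union_of_subset hUX]
    obtain ⟨u, hu⟩ := hne
    -- Degrees drop by at most 4 per cycle; the fifth unit guarantees a neighbour outside `U`, even
    -- for the last cycle.
    have hne' : (X \ U).Nonempty := by
      have h1 := hdeg u (hUX hu)
      have h2 := hsplit u (hUX hu)
      obtain ⟨w, hw⟩ := Finset.card_pos.1 (by omega : 0 < ((X \ U).filter (Γ.Adj u)).card)
      exact ⟨w, (Finset.mem_filter.1 hw).1⟩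
    obtain ⟨W, hW1, hW2⟩ := ih hne' fun x hx => by
      have h1 := hdeg x (Finset.mem_sdiff.1 hx).1
      have h2 := hsplit x (Finset.mem_sdiff.1 hx).1
      omega
    have hdisj : ∀ i, Disjoint U (W i) := fun i =>
      Finset.disjoint_sdiff.mono_right (hW2 i).1
    refine ⟨Fin.cons U W, ?_, ?_⟩
    · intro i j hij
      induction i using Fin.cases with
      | zero =>
        induction j using Fin.cases with
        | zero => exact absurd rfl hij
        | succ j => exact hdisj j
      | succ i =>
        induction j using Fin.cases with
        | zero => exact (hdisj i).symm
        | succ j => exact hW1 fun h => hij (congrArg Fin.succ h)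
    · intro i
      induction i using Fin.cases with
      | zero => exact ⟨hUX, ⟨u, hu⟩, hUd⟩
      | succ i => exact ⟨(hW2 i).1.trans Finset.sdiff_subset, (hW2 i).2⟩

end SimpleGraph

/-! ### Disjoint cycles from minimum degree three and large girth -/

namespace SimpleGraph

variable {V : Type*} {Γ : SimpleGraph V}

lemma height_iterate_le {h : V → ℕ} {f : V → V} (hf : ∀ v, h v ≠ 0 → h (f v) < h v)
    (hf0 : ∀ v, h v = 0 → f v = v) (n : ℕ) (v : V) : h (f^[n] v) ≤ h v - n := by
  induction n with
  | zero => simp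
  | succ n ih =>
    rw [Function.iterate_succ_apply']
    by_cases h0 : h (f^[n] v) = 0
    · rw [hf0 _ h0, h0]
      exact Nat.zero_le _
    · have := hf _ h0
      omega

open Classical in
/-- A spanning family of rooted trees given by heights and parents. -/
noncomputable def RootedForest.ofParent (h : V → ℕ) (p : V → V) (D : ℕ) (hD : ∀ v, h v ≤ D)
    (hp : ∀ v, h v ≠ 0 → Γ.Adj v (p v) ∧ h (p v) < h v) : RootedForest Γ where
  carrier := Set.univ
  height := h
  parent := p
  root := (fun v => if h v = 0 then v else p v)^[D]
  root_eq v _ h0 := Function.iterate_fixed (by simp [h0]) D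
  adj_parent v _ h0 := (hp v h0).1
  parent_mem _ _ _ := Set.mem_univ _
  height_parent v _ h0 := (hp v h0).2
  root_parent v _ h0 := by
    set f : V → V := fun v => if h v = 0 then v else p v with hf
    have h1 : f v = p v := if_neg h0
    have h2 := height_iterate_le (h := h) (f := f) (fun v hv => by simp [hf, hv, (hp v hv).2])
      (fun v hv => by simp [hf, hv]) D v
    have h3 : h (f^[D] v) = 0 := by
      have := hD v
      omega
    rw [← h1, ← Function.iterate_succ_apply, Function.iterate_succ_apply']
    exact if_pos h3

lemma RootedForest.height_root_ofParent {h : V → ℕ} {p : V → V} {D : ℕ} (hD : ∀ v, h v ≤ D)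
    (hp : ∀ v, h v ≠ 0 → Γ.Adj v (p v) ∧ h (p v) < h v) (v : V) :
    h ((RootedForest.ofParent h p D hD hp).root v) = 0 := by
  classical
  have h2 := height_iterate_le (h := h) (f := fun v => if h v = 0 then v else p v)
    (fun v hv => by simp [hv, (hp v hv).2]) (fun v hv => by simp [hv]) D v
  have := hD v
  refine Nat.le_zero.1 (le_trans ?_ (h2.trans (by omega : h v - D ≤ 0)))
  refine le_of_eq (congrArg h ?_)
  simp only [RootedForest.ofParent]

/-- Breadth-first search from a set `X` that is within distance `D` of every vertex. -/
lemma exists_rootedForest (X : Set V) (D : ℕ)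
    (hX : ∀ v, ∃ x ∈ X, ∃ q : Γ.Walk v x, q.length ≤ D) :
    ∃ F : RootedForest Γ, F.carrier = Set.univ ∧ (∀ v, F.height v ≤ D) ∧ (∀ v, F.root v ∈ X) ∧
      ∀ v, ∀ x ∈ X, ∀ q : Γ.Walk v x, F.height v ≤ q.length := by
  classical
  have hex : ∀ v, ∃ n, ∃ x ∈ X, ∃ q : Γ.Walk v x, q.length = n := fun v => by
    obtain ⟨x, hx, q, -⟩ := hX v
    exact ⟨_, x, hx, q, rfl⟩
  set h : V → ℕ := fun v => Nat.find (hex v) with hh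
  have hle : ∀ v, ∀ x ∈ X, ∀ q : Γ.Walk v x, h v ≤ q.length := fun v x hx q =>
    Nat.find_min' (hex v) ⟨x, hx, q, rfl⟩
  have hD : ∀ v, h v ≤ D := fun v => by
    obtain ⟨x, hx, q, hq⟩ := hX v
    exact (hle v x hx q).trans hq
  have hpar : ∀ v, ∃ w, h v ≠ 0 → Γ.Adj v w ∧ h w < h v := by
    intro v
    obtain ⟨x, hx, q, hq⟩ := Nat.find_spec (hex v)
    have hq : q.length = h v := hq
    cases q with
    | nil => exact ⟨v, fun h0 => absurd hq.symm h0⟩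
    | @cons _ w _ hadj q =>
      refine ⟨w, fun _ => ⟨hadj, ?_⟩⟩
      have := hle w x hx q
      rw [Walk.length_cons] at hq
      omega
  choose p hp using hpar
  refine ⟨RootedForest.ofParent h p D hD hp, rfl, hD, fun v => ?_, hle⟩
  have h0 := RootedForest.height_root_ofParent hD hp v
  obtain ⟨x, hx, q, hq⟩ := Nat.find_spec (hex ((RootedForest.ofParent h p D hD hp).root v))
  rw [Walk.eq_of_length_eq_zero (hq.trans h0)]
  exact hx

-- In a largest `s`-separated set, no vertex can be farther than `s` from all members, since it
-- could be added.
open Classical in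
lemma exists_separated [Fintype V] (s : ℕ) :
    ∃ X : Finset V, (∀ x ∈ X, ∀ y ∈ X, ∀ q : Γ.Walk x y, q.length ≤ s → x = y) ∧
      ∀ v, ∃ x ∈ X, ∃ q : Γ.Walk v x, q.length ≤ s := by
  obtain ⟨X, hX, hmax⟩ := Finset.exists_max_image
    (Finset.univ.filter fun X : Finset V =>
      ∀ x ∈ X, ∀ y ∈ X, ∀ q : Γ.Walk x y, q.length ≤ s → x = y) Finset.card ⟨∅, by simp⟩
  simp only [Finset.mem_filter, Finset.mem_univ, true_and] at hX hmax
  refine ⟨X, hX, fun v => ?_⟩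
  by_contra! hno
  have hv : v ∉ X := fun hv => by simpa using hno v hv .nil
  have := hmax (insert v X) (by
    intro x hx y hy q hq
    rcases Finset.mem_insert.1 hx with rfl | hx' <;> rcases Finset.mem_insert.1 hy with rfl | hy'
    · rfl
    · exact absurd (hno y hy' q) (not_lt.2 hq)
    · exact absurd (hno x hx' q.reverse) (by simpa using hq)
    · exact hX x hx' y hy' q hq)
  rw [Finset.card_insert_of_notMem hv] at this
  omega

open Classical in
/-- Graphs of minimum degree at least three and girth logarithmic in `k` contain `k` disjoint
cycles. -/
theorem exists_disjoint_walks [Fintype V] [Nonempty V] (hdeg : ∀ v, 3 ≤ Γ.degree v) {r k : ℕ}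
    (hk : 5 * k ≤ 2 ^ r) (h : Γ.NoShortCycle (8 * r + 2)) :
    ∃ W : Fin k → Set V, (Pairwise fun i j => Disjoint (W i) (W j)) ∧ ∀ i, ∃ a b, Γ.Adj a b ∧
      ∃ p : Γ.Walk b a, s(a, b) ∉ p.edges ∧ ∀ x ∈ p.support, x ∈ W i := by
  obtain ⟨X, hXsep, hXcov⟩ := exists_separated (Γ := Γ) (2 * r)
  obtain ⟨F, hcar, hD, hroot, hdist⟩ := exists_rootedForest (Γ := Γ) (X : Set V) (2 * r)
    (by simpa using hXcov)
  have hmem : ∀ v, v ∈ F.carrier := fun v => hcar ▸ Set.mem_univ v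
  have h' : Γ.NoShortCycle (4 * (2 * r) + 2) := h.mono (by omega)
  have hX : X.Nonempty := by
    obtain ⟨x, hx, -⟩ := hXcov (Classical.arbitrary V)
    exact ⟨x, hx⟩
  have hminor : ∀ x ∈ X, 5 * k ≤ (X.filter (F.minor.Adj x)).card := by
    intro x hx
    set B := Finset.univ.filter fun v => F.root v = x with hB
    -- A vertex within `r` of `x` has height at most `r`, so its root is within `2r` of `x` and
    -- equals `x` by separation. The whole ball of radius `r` therefore lies in the tree of `x`.
    have hball : 2 ^ r ≤ B.card := by
      obtain ⟨u, hu⟩ := Finset.card_pos.1 ((by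
        rw [card_neighborFinset_eq_degree]
        have := hdeg x
        omega) : 0 < (Γ.neighborFinset x).card)
      have hu : Γ.Adj x u := by simpa using hu
      refine (two_pow_le_nbCount hdeg r hu.symm).trans ?_
      refine NoShortCycle.nbCount_le (h.mono (by omega)) hu.symm fun v hv hvr => ?_
      obtain ⟨q, hq⟩ := hv.exists_walk_length_eq_dist
      obtain ⟨q', hq', -⟩ := F.exists_walk_root (hmem v)
      have h1 := hdist v x hx q.reverse
      rw [Walk.length_reverse] at h1
      simp only [hB, Finset.mem_filter, Finset.mem_univ, true_and]
      refine (hXsep x hx _ (hroot v) (q.append q') ?_).symm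
      rw [Walk.length_append]
      omega
    -- At least `3|B|` darts start in the tree and at most `2|B|` are tree darts, so `x` has at
    -- least `|B| ≥ 2^r ≥ 5k` neighbours in the minor.
    have h1 := F.card_darts_le (fun v _ => hD v) h' {x} X (fun v _ => hroot v)
    simp only [hmem, true_and, Finset.mem_singleton, Finset.sum_singleton] at h1
    rw [← hB] at h1
    have h2 : (Finset.univ.filter fun v => F.root v = x ∧ F.height v ≠ 0).card ≤ B.card :=
      Finset.card_le_card fun v hv => by
        simp only [hB, Finset.mem_filter] at hv ⊢
        exact ⟨hv.1, hv.2.1⟩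
    have h3 := (Finset.card_nsmul_le_sum B _ 3 fun v _ => (hdeg v).trans ?_).trans h1
    · rw [smul_eq_mul] at h3
      omega
    · rw [← card_neighborFinset_eq_degree]
      exact Finset.card_le_card fun w hw => by simpa using hw
  obtain ⟨U, hU1, hU2⟩ := exists_disjoint_of_le_degree k hX hminor
  refine ⟨fun i => {v | F.root v ∈ U i}, ?_, fun i => ?_⟩
  · intro i j hij
    rw [Set.disjoint_left]
    exact fun v hv hv' => Finset.disjoint_left.1 (hU1 hij) hv hv'
  · obtain ⟨a, b, ⟨-, u, v, huv, rfl, rfl⟩, P, hP, hPU⟩ :=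
      F.minor.exists_walk_of_card_le (hU2 i).2.1 (hU2 i).2.2
    obtain ⟨q, -, hq, hqU⟩ := F.exists_walk_of_minor_walk (fun v _ => hD v) huv P hP
      (hmem v) (hmem u) rfl rfl
    exact ⟨u, v, huv.adj, q, hq, fun x hx => hPU _ (hqU x hx).2⟩

end SimpleGraph

/-! ### Back to multigraphs, and the Erdős–Pósa theorem -/

namespace Graph

variable {α : Type u} {β : Type v} {G R : Graph α β}

/-- The simple graph of adjacent pairs of distinct vertices. -/
def simpleGraph (R : Graph α β) : SimpleGraph V(R) where
  Adj a b := a ≠ b ∧ R.Adj a b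
  symm := ⟨fun _ _ h => ⟨h.1.symm, h.2.symm⟩⟩
  loopless := ⟨fun _ h => h.1 rfl⟩

lemma exists_cycle_of_simpleGraph_walk {a b : V(R)} (hab : R.simpleGraph.Adj a b)
    (p : R.simpleGraph.Walk b a) (hp : s(a, b) ∉ p.edges) :
    ∃ C : R.Cycle, C.len ≤ p.length + 1 ∧ ∀ x ∈ C.verts, ∃ v ∈ p.support, (v : α) = x :=
  exists_cycle_of_walk (Γ := R.simpleGraph) Subtype.val_injective (fun _ _ h => h.2) hab p hp

lemma noShortCycle_simpleGraph {g : ℕ} (hg : ∀ C : R.Cycle, g < C.len) :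
    R.simpleGraph.NoShortCycle g := fun a b hab p hp => by
  obtain ⟨C, hC, -⟩ := exists_cycle_of_simpleGraph_walk hab p hp
  have := hg C
  omega

open Classical in
lemma three_le_degree_simpleGraph [Fintype V(R)] (hE : E(R).Finite)
    (hR : ∀ H, ¬ ReductionStep R H) (hg : ∀ C : R.Cycle, 2 < C.len) (v : V(R)) :
    3 ≤ R.simpleGraph.degree v := by
  obtain ⟨a, b, c, hab, hac, hbc, ha, hb, hc⟩ := exists_three_adj hE hR hg v.2
  have hne : ∀ w, R.Adj v w → (v : α) ≠ w := by
    rintro w ⟨e, he⟩ heq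
    rw [← heq] at he
    obtain ⟨C, hC, -⟩ := exists_cycle_of_isLoopAt he
    have := hg C
    omega
  rw [← SimpleGraph.card_neighborFinset_eq_degree]
  have hsub : ({⟨a, ha.right_mem⟩, ⟨b, hb.right_mem⟩, ⟨c, hc.right_mem⟩} : Finset V(R)) ⊆
      R.simpleGraph.neighborFinset v := by
    intro w hw
    simp only [Finset.mem_insert, Finset.mem_singleton] at hw
    rw [SimpleGraph.mem_neighborFinset]
    rcases hw with rfl | rfl | rfl
    · exact ⟨fun h => hne _ ha (congrArg Subtype.val h), ha⟩
    · exact ⟨fun h => hne _ hb (congrArg Subtype.val h), hb⟩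
    · exact ⟨fun h => hne _ hc (congrArg Subtype.val h), hc⟩
  refine le_trans (le_of_eq ?_) (Finset.card_le_card hsub)
  rw [Finset.card_insert_of_notMem (by simp [hab, hac]), Finset.card_pair (by simp [hbc])]

/-- The size of a reduced multigraph of girth larger than `g` is bounded in terms of the size of a
feedback vertex set. -/
theorem ncard_vertexSet_le (hV : V(R).Finite) (hE : E(R).Finite) (hR : ∀ H, ¬ ReductionStep R H)
    {g : ℕ} (hg : 6 < g) (hgirth : ∀ C : R.Cycle, g < C.len) {F : Set α} (hF : F.Finite)
    (hFc : ¬ R.HasCycleIn Fᶜ) {B : ℝ} (hB : (F.ncard : ℝ) ≤ B) :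
    (V(R).ncard : ℝ) ≤ (2 * B) ^ (1 + 6 / ((g : ℝ) - 6)) + 3 * B := by
  classical
  have := hV.fintype
  set A : Finset V(R) := Finset.univ.filter fun v => (v : α) ∈ F with hA
  have hAF : A.card ≤ F.ncard := by
    rw [← Set.ncard_coe_finset, ← Set.ncard_image_of_injective _ Subtype.val_injective]
    refine Set.ncard_le_ncard ?_ hF
    rintro _ ⟨v, hv, rfl⟩
    simpa [hA] using hv
  have hforest : ∑ v ∈ Aᶜ, (Aᶜ.filter (R.simpleGraph.Adj v)).card ≤ 2 * Aᶜ.card := by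
    -- The cycle criterion needs a nonempty set; for empty `Aᶜ` both sides are zero.
    rcases Aᶜ.eq_empty_or_nonempty with h0 | hne
    · simp [h0]
    · by_contra! hlt
      obtain ⟨a, b, hab, p, hp, hps⟩ := R.simpleGraph.exists_walk_of_card_le hne hlt.le
      obtain ⟨C, -, hC⟩ := exists_cycle_of_simpleGraph_walk hab p hp
      refine hFc ⟨C, fun x hx => ?_⟩
      obtain ⟨v, hv, rfl⟩ := hC x hx
      have := hps v hv
      simpa [hA] using this
  rw [← Nat.card_coe_set_eq, Nat.card_eq_fintype_card]
  refine SimpleGraph.card_le_of_forest (Γ := R.simpleGraph) (fun v => ?_) hg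
    (noShortCycle_simpleGraph hgirth) A (by convert hforest)
    (le_trans (by exact_mod_cast hAF) hB)
  convert three_le_degree_simpleGraph hE hR (fun C => by have := hgirth C; omega) v

/-- A nonempty reduced multigraph of large girth has many disjoint cycles. -/
theorem hasDisjointCycles_of_girth (hV : V(R).Finite) (hne : V(R).Nonempty) (hE : E(R).Finite)
    (hR : ∀ H, ¬ ReductionStep R H) {r k : ℕ} (hk : 5 * k ≤ 2 ^ r)
    (hgirth : ∀ C : R.Cycle, 8 * r + 2 < C.len) : R.HasDisjointCycles k := by
  classical
  have := hV.fintype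
  have := hne.to_subtype
  obtain ⟨W, hW1, hW2⟩ := SimpleGraph.exists_disjoint_walks (Γ := R.simpleGraph)
    (fun v => by
      convert three_le_degree_simpleGraph hE hR (fun C => by have := hgirth C; omega) v) hk
    (noShortCycle_simpleGraph hgirth)
  rw [hasDisjointCycles_iff]
  refine ⟨fun i => Subtype.val '' W i, fun i j hij => ?_, fun i => ?_⟩
  · exact (Set.disjoint_image_iff Subtype.val_injective).2 (hW1 hij)
  · obtain ⟨a, b, hab, p, hp, hpW⟩ := hW2 i
    obtain ⟨C, -, hC⟩ := exists_cycle_of_simpleGraph_walk hab p hp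
    refine ⟨C, fun x hx => ?_⟩
    obtain ⟨v, hv, rfl⟩ := hC x hx
    exact ⟨v, hpW v hv, rfl⟩

lemma HasDisjointCycles.insert {k : ℕ} (C : G.Cycle)
    (h : (G.deleteVerts C.verts).HasDisjointCycles k) : G.HasDisjointCycles (k + 1) := by
  rw [hasDisjointCycles_iff]
  obtain ⟨D, hD⟩ := h
  have hdisj : ∀ i, Disjoint C.verts (D i).verts := fun i =>
    (D i).isCore.disjoint_of_deleteVerts.symm
  refine ⟨Fin.cons C.verts fun i => (D i).verts, ?_, fun i => ?_⟩
  · intro i j hij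
    induction i using Fin.cases with
    | zero =>
      induction j using Fin.cases with
      | zero => exact absurd rfl hij
      | succ j => exact hdisj j
    | succ i =>
      induction j using Fin.cases with
      | zero => exact (hdisj i).symm
      | succ j => exact hD fun h => hij (congrArg Fin.succ h)
  · induction i using Fin.cases with
    | zero => exact ⟨C, le_rfl⟩
    | succ i => exact HasCycleIn.of_le ⟨D i, le_rfl⟩ deleteVerts_le

/-- Repeatedly reducing the multigraph and removing short cycles. -/
lemma hasDisjointCycles_or_exists {r k : ℕ} (hk : 5 * k ≤ 2 ^ r) (j : ℕ) (hV : V(G).Finite)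
    (hE : E(G).Finite) : G.HasDisjointCycles k ∨ G.HasDisjointCycles j ∨
      ∃ F ⊆ V(G), F.ncard ≤ j * (8 * r + 2) ∧ ¬ G.HasCycleIn Fᶜ := by
  -- `k` stays fixed because `r` depends on it; only the number `j` of cycles still to be removed
  -- decreases.
  induction j generalizing G with
  | zero => exact Or.inr (Or.inl ⟨fun i => i.elim0, fun i => i.elim0⟩)
  | succ j ih =>
    obtain ⟨R, hGR, hR⟩ := exists_isReduced hV hE
    have hVG := vertexSet_subset_of_reduction hGR
    have hVR := hV.subset hVG
    have hER := edgeSet_finite_of_reduction hGR hE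
    by_cases hshort : ∃ C : R.Cycle, C.len ≤ 8 * r + 2
    · obtain ⟨C, hC⟩ := hshort
      rcases ih (G := R.deleteVerts C.verts) (hVR.subset deleteVerts_le.vertexSet_mono)
        (hER.subset deleteVerts_le.edgeSet_mono) with h | h | ⟨F, hFV, hF, hFc⟩
      · exact Or.inl (hasDisjointCycles_of_reduction hGR hV (h.of_le deleteVerts_le))
      · exact Or.inr (Or.inl (hasDisjointCycles_of_reduction hGR hV h.insert))
      · refine Or.inr (Or.inr ⟨F ∪ C.verts, ?_, ?_, fun hcyc => ?_⟩)
        · refine Set.union_subset ?_ (C.isCore.subset_vertexSet.trans hVG)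
          exact (hFV.trans deleteVerts_le.vertexSet_mono).trans hVG
        · have h1 : C.verts.ncard ≤ 8 * r + 2 := by
            refine le_trans ?_ hC
            rw [Cycle.verts, ← Set.image_univ]
            refine (Set.ncard_image_le Set.finite_univ).trans ?_
            simp [Cycle.len, Set.ncard_univ]
          have := Set.ncard_union_le F C.verts
          rw [add_mul, one_mul]
          omega
        -- Reduction preserves cycles avoiding a given set, so a set meeting all cycles of `R` also
        -- meets those of `G`.
        · obtain ⟨U, hU, hc⟩ := (hasCycleIn_of_reduction hGR hV hE hcyc).exists_isCore
          rw [Set.compl_union, Set.subset_inter_iff] at hU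
          exact hFc (((hc.deleteVerts (Set.subset_compl_iff_disjoint_right.1 hU.2)).hasCycleIn
            (hVR.subset deleteVerts_le.vertexSet_mono)).mono hU.1)
    · push Not at hshort
      rcases V(R).eq_empty_or_nonempty with h0 | hne
      · refine Or.inr (Or.inr ⟨∅, Set.empty_subset _, by simp, fun hcyc => ?_⟩)
        obtain ⟨C, -⟩ := hasCycleIn_of_reduction hGR hV hE hcyc
        obtain ⟨x, hx⟩ := C.isCore.1
        have := C.isCore.subset_vertexSet hx
        simp [h0] at this
      · exact Or.inl (hasDisjointCycles_of_reduction hGR hV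
          (hasDisjointCycles_of_girth hVR hne hER hR hk hshort))

/-- The Erdős–Pósa theorem. -/
theorem isErdosPosaConstant : IsErdosPosaConstant.{u, v} 42 := by
  intro α β G k hV hE
  -- For `k < 2` the bound is zero, so either `G` is acyclic or one cycle must suffice.
  rcases Nat.lt_or_ge k 2 with hk | hk
  · by_cases hc : IsEmpty G.Cycle
    · refine Or.inr ⟨∅, ⟨Set.empty_subset _, by simpa using hc⟩, ?_⟩
      interval_cases k <;> simp
    · rw [not_isEmpty_iff] at hc
      obtain ⟨C⟩ := hc
      refine Or.inl ⟨fun _ => C, fun i j hij => absurd (Fin.ext (by omega)) hij⟩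
  -- The 3 gives `5k ≤ 8k ≤ 2^r`. Then `8r + 2 ≤ 8 (log k + 4) + 2 ≤ 42 log k`, as `log k ≥ 1`.
  · set r := Nat.clog 2 k + 3 with hr
    have hkr : 5 * k ≤ 2 ^ r := by
      have := Nat.le_pow_clog (b := 2) (by norm_num) k
      rw [hr, pow_add]
      omega
    rcases hasDisjointCycles_or_exists hkr k hV hE with h | h | ⟨F, hFV, hF, hFc⟩
    · exact Or.inl h
    · exact Or.inl h
    · refine Or.inr ⟨F, ⟨hFV, (not_hasCycleIn_compl_iff hV).1 hFc⟩, ?_⟩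
      have hk2 : (2 : ℝ) ≤ k := by exact_mod_cast hk
      have hlog1 : 1 ≤ Real.logb 2 k := by
        rw [Real.le_logb_iff_rpow_le (by norm_num) (by linarith)]
        simpa using hk2
      have hclog : (Nat.clog 2 k : ℝ) ≤ Real.logb 2 k + 1 := by
        have h1 : 2 ^ (Nat.clog 2 k - 1) < k := Nat.pow_pred_clog_lt_self (by norm_num) hk
        have h2 : ((Nat.clog 2 k - 1 : ℕ) : ℝ) ≤ Real.logb 2 k := by
          rw [Real.le_logb_iff_rpow_le (by norm_num) (by linarith), Real.rpow_natCast]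
          exact_mod_cast h1.le
        have h3 : Nat.clog 2 k ≤ (Nat.clog 2 k - 1) + 1 := by omega
        have h4 : (Nat.clog 2 k : ℝ) ≤ ((Nat.clog 2 k - 1 : ℕ) : ℝ) + 1 := by exact_mod_cast h3
        linarith
      have h5 : (F.ncard : ℝ) ≤ k * (8 * (Nat.clog 2 k + 3) + 2) := by exact_mod_cast hF
      have h6 : (k : ℝ) * (8 * (Nat.clog 2 k + 3) + 2) ≤ k * (42 * Real.logb 2 k) := by
        refine mul_le_mul_of_nonneg_left ?_ (by linarith)
        linarith
      linarith

end Graph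

theorem lemma3 :
    (∃ c : ℝ, 0 < c ∧ Graph.IsErdosPosaConstant.{u, v} c) ∧
    ∀ (c : ℝ) (α : Type u) (β : Type v) (G : Graph α β) (k g : ℕ) (S : Set α) (R : Graph α β),
      V(G).Finite → E(G).Finite → 0 < k → 6 < g → Graph.IsPackingOutput c G k g S R →
        (V(R).ncard : ℝ) ≤
          (2 * c * k * Real.logb 2 k) ^ (1 + 6 / ((g : ℝ) - 6)) + 3 * c * k * Real.logb 2 k := by
  refine ⟨⟨42, by norm_num, Graph.isErdosPosaConstant⟩, ?_⟩
  rintro c α β G k g S R hV hE - hg ⟨⟨F, ⟨hFV, hFc⟩, hF⟩, -, ⟨hGR, hR⟩, hgirth⟩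
  have hVS : V(G.deleteVerts S).Finite := hV.subset Graph.deleteVerts_le.vertexSet_mono
  have hES : E(G.deleteVerts S).Finite := hE.subset Graph.deleteVerts_le.edgeSet_mono
  have hgirth' : ∀ C : R.Cycle, g < C.len := fun C => by
    exact_mod_cast hgirth.trans_le (iInf_le _ C)
  -- `F` may contain vertices of `S`, so it is carried along as a set meeting all cycles rather than
  -- as a feedback vertex set of `G - S`.
  obtain ⟨F', hF'fin, hF'card, hF'c⟩ := Graph.exists_not_hasCycleIn_of_reduction hGR hVS
    (hV.subset hFV) fun h => (Graph.not_hasCycleIn_compl_iff hV).2 hFc (h.of_le Graph.deleteVerts_le)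
  have := Graph.ncard_vertexSet_le (hVS.subset (Graph.vertexSet_subset_of_reduction hGR))
    (Graph.edgeSet_finite_of_reduction hGR hES) hR hg hgirth' hF'fin hF'c
    (le_trans (by exact_mod_cast hF'card) hF)
  calc (V(R).ncard : ℝ) ≤ _ := this
    _ = _ := by ring_nf
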